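/- Let $R$ be an associative ring with $1$ that is right Artinian or left Artinian, let $C$ be its center, and suppose that for every maximal ideal $\mathfrak m$ of $C$ the residue field $C/\mathfrak m$ has at least seven elements. Let $n$ be a natural number, let $\mathrm{GL}(n,R)$ be the group of invertible $n\times n$ matrices over $R$, and let $\mathrm D(n,R)$ be its subgroup of matrices $\mathrm{diag}(u_1,\dots,u_n)$ with $u_1,\dots,u_n\in R^\times$. A $D$-net of order $n$ over $R$ is a family $\sigma=(\sigma_{ij})_{1\le i,j\le n}$ of two-sided ideals of $R$ such that $\sigma_{ir}\sigma_{rj}\subseteq\sigma_{ij}$ for all $i,r,j$ and $\sigma_{ii}=R$ for all $i$. Its net subgroup $G(\sigma)$ is the largest subgroup of $\mathrm{GL}(n,R)$ all of whose elements $g=(g_{ij})$ satisfy $g_{ij}\in\sigma_{ij}$ for all $i,j$ (that is, the group of all $g\in\mathrm{GL}(n,R)$ such that $g$ and $g^{-1}$ both have this property), and $\mathcal N(\sigma)$ is the normalizer of $G(\sigma)$ in $\mathrm{GL}(n,R)$. Then for every subgroup $F$ with $\mathrm D(n,R)\le F\le\mathrm{GL}(n,R)$ there exists a unique $D$-net $\sigma$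 of order $n$ over $R$ such that $G(\sigma)\le F\le\mathcal N(\sigma)$. If, moreover, $R$ has only finitely many two-sided ideals, then for this $\sigma$ the index $(F:G(\sigma))$ is finite. -/

import Mathlib

/-- A `D`-net of order `n` over `R`: a square array of two-sided ideals `σ i j` of `R` with
`σ i r * σ r j ⊆ σ i j` for all `i, r, j`, all of whose diagonal entries are `R`. -/
structure DNet (n : ℕ) (R : Type*) [Ring R] where
  ideal : Fin n → Fin n → TwoSidedIdeal R
  mul_mem : ∀ (i r j : Fin n) (a b : R), a ∈ ideal i r → b ∈ ideal r j → a * b ∈ ideal i j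
  diag : ∀ i : Fin n, ideal i i = ⊤

/-- The group `D(n, R)` of invertible diagonal matrices: the matrices `diag(u₁, …, uₙ)`
with `u₁, …, uₙ` units of `R`. -/
def diagonalSubgroup (n : ℕ) (R : Type*) [Ring R] : Subgroup (Matrix.GeneralLinearGroup (Fin n) R) :=
  (Units.map ((Matrix.diagonalRingHom (Fin n) R : (Fin n → R) →+* Matrix (Fin n) (Fin n) R) :
    (Fin n → R) →* Matrix (Fin n) (Fin n) R)).range

namespace DNet

variable {n : ℕ} {R : Type*} [Ring R]

/-- The set `M(σ)` of matrices whose `(i, j)` entry lies in `σ i j`, for all `i, j`. -/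
def matrices (σ : DNet n R) : Set (Matrix (Fin n) (Fin n) R) :=
  {a | ∀ i j, a i j ∈ σ.ideal i j}

theorem one_mem_matrices (σ : DNet n R) : (1 : Matrix (Fin n) (Fin n) R) ∈ σ.matrices := by
  intro i j
  by_cases h : i = j
  · subst h
    rw [σ.diag]
    trivial
  · rw [Matrix.one_apply_ne h]
    exact (σ.ideal i j).zero_mem

theorem mul_mem_matrices (σ : DNet n R) {a b : Matrix (Fin n) (Fin n) R}
    (ha : a ∈ σ.matrices) (hb : b ∈ σ.matrices) : a * b ∈ σ.matrices := by
  intro i j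
  rw [Matrix.mul_apply]
  exact sum_mem fun r _ => σ.mul_mem i r j _ _ (ha i r) (hb r j)

/-- The net subgroup `G(σ)`: the largest subgroup of `GL(n, R)` contained in `M(σ)`
(see `isGreatest_netSubgroup`). -/
def netSubgroup (σ : DNet n R) : Subgroup (Matrix.GeneralLinearGroup (Fin n) R) where
  carrier := {g | (g : Matrix (Fin n) (Fin n) R) ∈ σ.matrices ∧
    ((g⁻¹ : Matrix.GeneralLinearGroup (Fin n) R) : Matrix (Fin n) (Fin n) R) ∈ σ.matrices}
  one_mem' := by
    refine ⟨?_, ?_⟩ <;> simpa using σ.one_mem_matrices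
  mul_mem' := by
    rintro a b ⟨ha, ha'⟩ ⟨hb, hb'⟩
    refine ⟨?_, ?_⟩
    · rw [Units.val_mul]
      exact σ.mul_mem_matrices ha hb
    · rw [mul_inv_rev, Units.val_mul]
      exact σ.mul_mem_matrices hb' ha'
  inv_mem' := by
    rintro a ⟨ha, ha'⟩
    exact ⟨ha', by rwa [inv_inv]⟩

theorem isGreatest_netSubgroup (σ : DNet n R) :
    IsGreatest {H : Subgroup (Matrix.GeneralLinearGroup (Fin n) R) |
      ∀ g ∈ H, (g : Matrix (Fin n) (Fin n) R) ∈ σ.matrices} σ.netSubgroup :=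
  ⟨fun _ hg => hg.1, fun H hH g hg => ⟨hH g hg, hH g⁻¹ (H.inv_mem hg)⟩⟩

end DNet

/-! Let `σ i j` consist of the x whose transvection at (i, j) lies in F. Diagonal conjugation
multiplies x by units and every element of R is a sum of units, so the `σ i j` are two-sided ideals;
commutators of transvections make σ a net (`DNet.ofSubgroup`). Since R has stable rank one
(`exists_isUnit_add_mul`), Gaussian elimination generates G(σ) by transvections and diagonal
matrices, whence G(σ) ≤ F (`DNet.netSubgroup_le`).

The core is F ≤ N(σ), which reduces to a_ir w (a⁻¹)_rk ∈ σ_ik for a ∈ F, i ≠ k and all w ∈ R. Let p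
and q be the conjugates by a of the diagonal matrices with 1 + θ, respectively 1 + φ, at place r,
and let d_k(c) have a central unit c at place k. One equation between θ and φ makes row k of p
d_k(c) q vanish off the diagonal, and such a matrix yields the transvection with entry a_ir (θ - φ)
(a⁻¹)_rk (`elemGL_mem_of_relation`). The solutions used depend on a central parameter t, and -t(θ -
φ) is quadratic in t; three values of t give the case w = 1 (`one_mem_sandwich`). Applying that case
to conjugates of diagonal matrices gives every w (`CentralUnits.mem_of_forall_isUnit`).

The Artinian condition enters only through Drazin inverses and the descending chain condition on
idempotents. Choices are made modulo a maximal ideal of a commutative bicommutant and glued along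
idempotents (`idempotent_cover`).

Uniqueness holds because a transvection normalizing G(τ) has its entry in τ. For finite index, the
two-sided ideals generated by the entries of an element of F determine its coset modulo G(σ). -/

/-! ### Drazin inverses and idempotents in Artinian rings. -/

/-- Every element `a` has a Drazin inverse `b` in its bicommutant: `a` is invertible on the range of
the idempotent `a * b` and nilpotent on the range of `1 - a * b`. -/
def HasFitting (R : Type*) [Ring R] : Prop :=
  ∀ a : R, ∃ b : R, (∀ s, Commute a s → Commute b s) ∧ IsIdempotentElem (a * b) ∧
    IsNilpotent (a * (1 - a * b))

/-- The strict order on the idempotents of `R`. -/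
def IdemLT {R : Type*} [Ring R] (f e : R) : Prop :=
  IsIdempotentElem f ∧ IsIdempotentElem e ∧ e * f = f ∧ f * e = f ∧ f ≠ e

/-- With p = a^(n+1), the element e = c p is an idempotent acting as the identity on p from both
sides, and q = c e inverts p relative to e. If s commutes with p, then e s and s e both equal e s e;
hence q, and b = a^n q, lie in the bicommutant. -/
theorem exists_drazin_of_pow {R : Type*} [Ring R] {a c : R} {n : ℕ}
    (hc : a ^ (n + 1) = c * (a ^ (n + 1) * a ^ (n + 1)))
    (hker : ∀ y, y * (a ^ (n + 1) * a ^ (n + 1)) = 0 → y * a ^ (n + 1) = 0) :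
    ∃ b : R, (∀ s, Commute a s → Commute b s) ∧ IsIdempotentElem (a * b) ∧
      IsNilpotent (a * (1 - a * b)) := by
  obtain ⟨p, hp⟩ : ∃ p, p = a ^ (n + 1) := ⟨_, rfl⟩
  rw [← hp] at hc hker
  have hpcp : p * c * p = p := by
    have : (p * c - 1) * (p * p) = 0 := by
      rw [sub_mul, one_mul, mul_assoc, ← hc, sub_self]
    have := hker _ this
    rwa [sub_mul, one_mul, sub_eq_zero] at this
  obtain ⟨e, he⟩ : ∃ e, e = c * p := ⟨_, rfl⟩
  have hep : e * p = p := by rw [he, mul_assoc, ← hc]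
  have hpe : p * e = p := by rw [he, ← mul_assoc, hpcp]
  have hee : e * e = e := by
    calc e * e = c * (p * e) := by rw [← mul_assoc, ← he]
      _ = e := by rw [hpe, ← he]
  obtain ⟨q, hq⟩ : ∃ q, q = c * e := ⟨_, rfl⟩
  have hqp : q * p = e := by rw [hq, mul_assoc, hep, ← he]
  have hpq : p * q = e := by
    have h1 : ((p * c - 1) * c) * (p * p) = 0 := by
      rw [mul_assoc, ← hc, sub_mul, one_mul, hpcp, sub_self]
    have h2 := hker _ h1
    rw [mul_assoc, ← he, sub_mul, one_mul, sub_eq_zero] at h2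
    rw [hq, ← mul_assoc, h2]
  have hqe : q * e = q := by rw [hq, mul_assoc, hee]
  have heq : e * q = q := by rw [← hqp, mul_assoc, hpq, hqe]
  have comm : ∀ s, p * s = s * p → e * s = s * e ∧ q * s = s * q := by
    intro s hs
    have h1 : e * s = e * s * e := by
      calc e * s = q * (p * s) := by rw [← mul_assoc, hqp]
        _ = q * (s * (p * e)) := by rw [hpe, hs]
        _ = q * (p * s) * e := by rw [hs]; simp only [mul_assoc]
        _ = e * s * e := by rw [← mul_assoc, hqp]
    have h2 : s * e = e * s * e := by
      calc s * e = s * p * q := by rw [mul_assoc, hpq]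
        _ = e * p * s * q := by rw [hep, hs]
        _ = e * (s * p) * q := by rw [← hs]; simp only [mul_assoc]
        _ = e * s * e := by rw [mul_assoc, mul_assoc, hpq, mul_assoc]
    have h3 : e * s = s * e := h1.trans h2.symm
    refine ⟨h3, ?_⟩
    calc q * s = q * e * s := by rw [hqe]
      _ = q * s * e := by rw [mul_assoc, h3, ← mul_assoc]
      _ = q * (s * p) * q := by rw [← hpq]; simp only [mul_assoc]
      _ = e * s * q := by rw [← hs, ← mul_assoc, hqp]
      _ = s * q := by rw [h3, mul_assoc, heq]
  have hab : a * (a ^ n * q) = e := by rw [← mul_assoc, ← pow_succ', ← hp, hpq]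
  have hpa : p * a = a * p := by rw [hp, ← pow_succ, ← pow_succ']
  refine ⟨a ^ n * q, fun s hs => ?_, ?_, n + 1, ?_⟩
  · have hps : p * s = s * p := by rw [hp]; exact hs.pow_left _
    exact (hs.pow_left n).mul_left (comm s hps).2
  · rw [hab]; exact hee
  · rw [hab]
    have hc1 : Commute a (1 - e) :=
      (Commute.one_right a).sub_right ((comm a hpa).1.symm)
    have hi : IsIdempotentElem (1 - e) := IsIdempotentElem.one_sub hee
    rw [hc1.mul_pow, hi.pow_eq (Nat.succ_ne_zero n), ← hp, mul_sub, hpe, mul_one, sub_self]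

/-- The left ideals R a^n descend and the left annihilators of a^n ascend. Both chains stabilise,
the second because a left Artinian ring is left Noetherian. -/
theorem HasFitting.of_isArtinianRing (R : Type*) [Ring R] [IsArtinianRing R] : HasFitting R := by
  intro a
  let f : ℕ →o (Submodule R R)ᵒᵈ :=
    ⟨fun n => OrderDual.toDual (Ideal.span {a ^ n}), monotone_nat_of_le_succ fun n => by
      change Ideal.span {a ^ (n + 1)} ≤ Ideal.span {a ^ n}
      rw [Ideal.span_singleton_le_iff_mem, Ideal.mem_span_singleton', pow_succ']
      exact ⟨a, rfl⟩⟩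
  obtain ⟨n, hn⟩ := IsArtinian.monotone_stabilizes f
  let g : ℕ →o Submodule R R :=
    ⟨fun n => LinearMap.ker (LinearMap.toSpanSingleton R R (a ^ n)),
      monotone_nat_of_le_succ fun n x hx => by
      simp only [LinearMap.mem_ker, LinearMap.toSpanSingleton_apply, smul_eq_mul] at hx ⊢
      rw [pow_succ, ← mul_assoc, hx, zero_mul]⟩
  obtain ⟨m, hm⟩ := monotone_stabilizes_iff_noetherian.2 (inferInstance : IsNoetherian R R) g
  obtain ⟨k, hk⟩ : ∃ k, k = n + m := ⟨_, rfl⟩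
  have h1 : (Ideal.span {a ^ (k + 1)} : Ideal R) = Ideal.span {a ^ ((k + 1) + (k + 1))} := by
    have e1 := hn (k + 1) (by omega)
    have e2 := hn ((k + 1) + (k + 1)) (by omega)
    exact e1.symm.trans e2
  have h2 : a ^ (k + 1) ∈ (Ideal.span {a ^ ((k + 1) + (k + 1))} : Ideal R) := by
    rw [← h1]; exact Ideal.mem_span_singleton_self _
  obtain ⟨c, hc⟩ := Ideal.mem_span_singleton'.1 h2
  refine exists_drazin_of_pow (n := k) (c := c) ?_ ?_
  · rw [← pow_add, hc]
  · intro y hy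
    have e1 := hm (k + 1) (by omega)
    have e2 := hm ((k + 1) + (k + 1)) (by omega)
    have e3 : g (k + 1) = g ((k + 1) + (k + 1)) := e1.symm.trans e2
    have : y ∈ g ((k + 1) + (k + 1)) := by
      change y ∈ LinearMap.ker _
      rw [LinearMap.mem_ker, LinearMap.toSpanSingleton_apply, smul_eq_mul, pow_add, hy]
    rw [← e3] at this
    change y ∈ LinearMap.ker _ at this
    rwa [LinearMap.mem_ker, LinearMap.toSpanSingleton_apply, smul_eq_mul] at this

theorem HasFitting.of_op {R : Type*} [Ring R] (h : HasFitting Rᵐᵒᵖ) : HasFitting R := by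
  intro a
  obtain ⟨b, hb, he, k, hk⟩ := h (MulOpposite.op a)
  have hab := (hb _ (Commute.refl _)).unop
  simp only [MulOpposite.unop_op] at hab
  refine ⟨b.unop, fun s hs => (hb _ hs.op).unop, ?_, k, ?_⟩
  · have := congrArg MulOpposite.unop he
    simp only [MulOpposite.unop_mul, MulOpposite.unop_op] at this
    rw [← hab.eq]; exact this
  · have := congrArg MulOpposite.unop hk
    simp only [MulOpposite.unop_mul, MulOpposite.unop_op, MulOpposite.unop_pow,
      MulOpposite.unop_sub, MulOpposite.unop_one, MulOpposite.unop_zero] at this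
    have hc : Commute a (1 - a * b.unop) := (Commute.one_right a).sub_right
      ((Commute.refl a).mul_right hab.symm)
    rw [hc.eq, ← hab.eq]; exact this

theorem hasFitting_of_isArtinian {R : Type*} [Ring R]
    (hArt : IsArtinian Rᵐᵒᵖ R ∨ IsArtinian R R) : HasFitting R := by
  rcases hArt with h | h
  · let e : R ≃ₗ[Rᵐᵒᵖ] Rᵐᵒᵖ :=
      { MulOpposite.opAddEquiv with
        map_smul' := fun _ _ => rfl }
    have : IsArtinianRing Rᵐᵒᵖ := isArtinian_of_linearEquiv e
    exact (HasFitting.of_isArtinianRing Rᵐᵒᵖ).of_op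
  · have : IsArtinianRing R := h
    exact HasFitting.of_isArtinianRing R

/-- f < e forces both fR ⊊ eR and Rf ⊊ Re, so a chain condition on either side suffices. -/
theorem wellFounded_idemLT {R : Type*} [Ring R]
    (hArt : IsArtinian Rᵐᵒᵖ R ∨ IsArtinian R R) : WellFounded (IdemLT (R := R)) := by
  rcases hArt with h | h
  · refine Subrelation.wf (r := InvImage (· < ·) fun e : R => Submodule.span Rᵐᵒᵖ {e}) ?_
      (InvImage.wf _ wellFounded_lt)
    rintro f e ⟨hf, he, h1, h2, h3⟩
    refine lt_of_le_of_ne ?_ fun heq => h3 ?_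
    · rw [Submodule.span_singleton_le_iff_mem, Submodule.mem_span_singleton]
      exact ⟨MulOpposite.op f, h1⟩
    · have : e ∈ Submodule.span Rᵐᵒᵖ {f} := by
        refine (le_of_eq heq.symm : _ ≤ _) ?_; exact Submodule.mem_span_singleton_self e
      obtain ⟨r, hr⟩ := Submodule.mem_span_singleton.1 this
      have hr' : f * r.unop = e := hr
      rw [← h2, ← hr', ← mul_assoc, hf]
  · refine Subrelation.wf (r := InvImage (· < ·) fun e : R => Submodule.span R {e}) ?_
      (InvImage.wf _ wellFounded_lt)
    rintro f e ⟨hf, he, h1, h2, h3⟩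
    refine lt_of_le_of_ne ?_ fun heq => h3 ?_
    · rw [Submodule.span_singleton_le_iff_mem, Submodule.mem_span_singleton]
      exact ⟨f, h2⟩
    · have : e ∈ Submodule.span R {f} := by
        refine (le_of_eq heq.symm : _ ≤ _) ?_; exact Submodule.mem_span_singleton_self e
      obtain ⟨r, hr⟩ := Submodule.mem_span_singleton.1 this
      have hr' : r * f = e := hr
      rw [← h1, ← hr', mul_assoc, hf]

/-- The idempotent 1 - x b kills a power of x; cancelling that power with the same power of y gives
x b = 1. -/
theorem HasFitting.mul_eq_one_symm {R : Type*} [Ring R] (h : HasFitting R) {x y : R}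
    (hxy : x * y = 1) : y * x = 1 := by
  obtain ⟨b, hb, he, k, hk⟩ := h x
  have hbx : Commute x b := (hb x (Commute.refl x)).symm
  have hc : Commute x (1 - x * b) := (Commute.one_right x).sub_right
      ((Commute.refl x).mul_right hbx)
  have hpow : ∀ k : ℕ, x ^ k * y ^ k = 1 := by
    intro k
    induction k with
    | zero => simp
    | succ k ih => rw [pow_succ, pow_succ', mul_assoc, ← mul_assoc x y, hxy, one_mul, ih]
  have h1 : (1 - x * b) * x ^ (k + 1) = 0 := by
    have hi : IsIdempotentElem (1 - x * b) := IsIdempotentElem.one_sub he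
    rw [← hi.pow_eq (Nat.succ_ne_zero k), ← hc.symm.mul_pow, ← hc.eq, pow_succ, hk, zero_mul]
  have h2 : x * b = 1 := by
    have := congrArg (· * y ^ (k + 1)) h1
    simp only [mul_assoc, hpow, mul_one, zero_mul] at this
    exact (sub_eq_zero.1 this).symm
  have h3 : b * x = 1 := hbx.eq ▸ h2
  calc y * x = b * x * y * x := by rw [h3, one_mul]
    _ = b * (x * y) * x := by simp only [mul_assoc]
    _ = 1 := by rw [hxy, mul_one, h3]

/-! ### Stable rank one. -/

/-- Here a is the identity on 1 - d and m = d a on d, and m is invertible on the nonzero idempotent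
g = m n. Dividing by the unit w that is m on g and 1 on 1 - g makes a the identity on 1 - (d - g),
so the induction hypothesis for d - g applies. -/
theorem exists_isUnit_add_mul_of_drazin_ne_zero {R : Type*} [Ring R] {d a b u v n : R}
    (hd : IsIdempotentElem d)
    (IH : ∀ d', IdemLT d' d → ∀ a u v : R, d' * a = a * d' → a - d' * a = 1 - d' →
      u * a + v * b = 1 → ∃ z, IsUnit (a + z * b))
    (hda : d * a = a * d) (ha : a - d * a = 1 - d) (huv : u * a + v * b = 1)
    (hn : Commute (d * a) n) (hg : IsIdempotentElem (d * a * n)) (hg0 : d * a * n ≠ 0) :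
    ∃ z, IsUnit (a + z * b) := by
  obtain ⟨m, hm⟩ : ∃ m, m = d * a := ⟨_, rfl⟩
  obtain ⟨g, hgm⟩ : ∃ g, g = m * n := ⟨_, rfl⟩
  rw [← hm] at hn hg hg0 ha
  rw [← hgm] at hg hg0
  have hdm : d * m = m := by rw [hm, ← mul_assoc, hd]
  have hmd : m * d = m := by rw [hm, hda, mul_assoc, hd]
  have hdg : d * g = g := by rw [hgm, ← mul_assoc, hdm]
  have hgd : g * d = g := by rw [hgm, hn.eq, mul_assoc, hmd]
  have hmg : m * g = g * m := by rw [hgm, mul_assoc, ← hn.eq]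
  have hng : n * g = g * n := by rw [hgm, ← mul_assoc, ← hn.eq]
  have hgg : g * g = g := hg
  have ha' : a = 1 - d + m := by rw [← ha]; abel
  have hw1 : ((1 - g) + m * g) * ((1 - g) + n * g) = 1 := by
    have : m * g * (n * g) = g := by
      rw [hng, mul_assoc, ← mul_assoc g g, hgg, ← hng, ← mul_assoc, ← hgm, hgg]
    have h1 : m * g * (1 - g) = 0 := by rw [mul_assoc, mul_sub, hgg, mul_one, sub_self, mul_zero]
    have h2 : (1 - g) * (n * g) = 0 := by
      rw [hng, ← mul_assoc, sub_mul, one_mul, hgg, sub_self, zero_mul]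
    rw [add_mul, mul_add, mul_add, this, h1, h2]
    simp only [sub_mul, mul_sub, hgg, one_mul, mul_one]; abel
  have hw2 : ((1 - g) + n * g) * ((1 - g) + m * g) = 1 := by
    have : n * g * (m * g) = g := by
      rw [hmg, mul_assoc, ← mul_assoc g g, hgg, ← hmg, ← mul_assoc, ← hn.eq, ← hgm, hgg]
    have h1 : n * g * (1 - g) = 0 := by rw [mul_assoc, mul_sub, hgg, mul_one, sub_self, mul_zero]
    have h2 : (1 - g) * (m * g) = 0 := by
      rw [hmg, ← mul_assoc, sub_mul, one_mul, hgg, sub_self, zero_mul]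
    rw [add_mul, mul_add, mul_add, this, h1, h2]
    simp only [sub_mul, mul_sub, hgg, one_mul, mul_one]; abel
  let w : Rˣ := ⟨(1 - g) + m * g, (1 - g) + n * g, hw1, hw2⟩
  have hwa : (↑w⁻¹ : R) * a = 1 - d + m * (1 - g) + g := by
    change ((1 - g) + n * g) * a = _
    have h1 : n * g * (1 - d) = 0 := by rw [mul_assoc, mul_sub, hgd, mul_one, sub_self, mul_zero]
    have h2 : n * g * m = g := by rw [mul_assoc, ← hmg, ← mul_assoc, ← hn.eq, ← hgm, hgg]
    rw [ha', add_mul, mul_add, mul_add, h1, h2]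
    have h3 : (1 - g) * (1 - d) = 1 - d := by
      rw [sub_mul, one_mul, mul_sub, hgd, mul_one, sub_self, sub_zero]
    rw [h3, sub_mul, mul_sub, one_mul, mul_one, ← hmg]; abel
  have hdd : IdemLT (d - g) d := by
    refine ⟨?_, hd, ?_, ?_, fun h => hg0 ?_⟩
    · rw [IsIdempotentElem, mul_sub, sub_mul, sub_mul, hd, hdg, hgd, hgg]; abel
    · rw [mul_sub, hd, hdg]
    · rw [sub_mul, hd, hgd]
    · simpa using h
  have hgk : g * (m * (1 - g)) = 0 := by
    rw [← mul_assoc, ← hmg, mul_assoc, mul_sub, hgg, mul_one, sub_self, mul_zero]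
  have hkg : m * (1 - g) * g = 0 := by rw [mul_assoc, sub_mul, hgg, one_mul, sub_self, mul_zero]
  have hkd : m * (1 - g) * d = m * (1 - g) := by
    rw [mul_assoc, sub_mul, one_mul, hgd, mul_sub, hmd, mul_sub, mul_one]
  have h1 : (d - g) * (↑w⁻¹ * a) = m * (1 - g) := by
    rw [hwa]
    have : (d - g) * (1 - d) = 0 := by
      simp only [sub_mul, mul_sub, hd.eq, hgd, mul_one]; simp
    rw [mul_add, mul_add, this, sub_mul, sub_mul, hgk, hdg, hgg, ← mul_assoc, hdm]; simp
  have h2 : ↑w⁻¹ * a * (d - g) = m * (1 - g) := by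
    rw [hwa]
    have : (1 - d) * (d - g) = 0 := by
      simp only [sub_mul, mul_sub, hd.eq, hdg, one_mul]; simp
    rw [add_mul, add_mul, this, mul_sub (m * (1 - g)), mul_sub g, hkg, hgd, hgg, hkd]; simp
  obtain ⟨z, hz⟩ := IH (d - g) hdd (↑w⁻¹ * a) (u * ↑w) v (h1.trans h2.symm)
    (by rw [h1, hwa]; abel) (by rw [mul_assoc, Units.mul_inv_cancel_left, huv])
  refine ⟨↑w * z, ?_⟩
  have := w.isUnit.mul hz
  rwa [mul_add, Units.mul_inv_cancel_left, ← mul_assoc] at this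

/-- A ring whose elements have Drazin inverses and whose idempotents satisfy the descending chain
condition has stable rank one. -/
theorem exists_isUnit_add_mul {R : Type*} [Ring R] (hF : HasFitting R)
    (hwf : WellFounded (IdemLT (R := R))) {a b u v : R} (huv : u * a + v * b = 1) :
    ∃ z, IsUnit (a + z * b) := by
  suffices H : ∀ d : R, IsIdempotentElem d → ∀ a u v : R, d * a = a * d → a - d * a = 1 - d →
      u * a + v * b = 1 → ∃ z, IsUnit (a + z * b) from
    H 1 IsIdempotentElem.one a u v (by simp) (by simp) huv
  intro d
  induction d using hwf.induction with
  | _ d IH =>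
  intro hd a u v hda ha huv
  replace IH : ∀ d', IdemLT d' d → ∀ a u v : R, d' * a = a * d' → a - d' * a = 1 - d' →
      u * a + v * b = 1 → ∃ z, IsUnit (a + z * b) := fun d' h => IH d' h h.1
  obtain ⟨n, hn, hg, hnil⟩ := hF (d * a)
  by_cases hg0 : d * a * n ≠ 0
  · exact exists_isUnit_add_mul_of_drazin_ne_zero hd IH hda ha huv (hn _ (Commute.refl _)).symm
      hg hg0
  rw [not_not] at hg0
  rw [hg0, sub_zero, mul_one] at hnil
  by_cases hd0 : d = 0
  · subst hd0
    exact ⟨0, by simp at ha; simp [ha]⟩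
  obtain ⟨m, hm⟩ : ∃ m, m = d * a := ⟨_, rfl⟩
  rw [← hm] at hnil ha
  have hdd : d * d = d := hd
  have hdm : d * m = m := by rw [hm, ← mul_assoc, hd]
  have hmd : m * d = m := by rw [hm, hda, mul_assoc, hd]
  -- Now m is nilpotent; k is the last nonzero d m^N. It will be fixed by the modified element,
  -- which therefore cannot be nilpotent on d.
  obtain ⟨k, hk0, hdk, hmk⟩ : ∃ k, k ≠ 0 ∧ d * k = k ∧ m * k = 0 := by
    classical
    have hex : ∃ N, d * m ^ N = 0 := by
      obtain ⟨N, hN⟩ := hnil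
      exact ⟨N, by rw [hN, mul_zero]⟩
    obtain ⟨N, hN⟩ : ∃ N, N = Nat.find hex := ⟨_, rfl⟩
    have hs := Nat.find_spec hex
    rw [← hN] at hs
    cases N with
    | zero => simp [hd0] at hs
    | succ N =>
      refine ⟨d * m ^ N, Nat.find_min hex (by omega), by rw [← mul_assoc, hd], ?_⟩
      rw [← mul_assoc, hmd, ← pow_succ', ← hs, pow_succ', ← mul_assoc, hdm]
  -- Adding d v b to a creates the corner term -d u (1 - d); the unipotent w removes it.
  let w : Rˣ := ⟨1 + d * u * (1 - d), 1 - d * u * (1 - d), by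
    have : d * u * (1 - d) * (d * u * (1 - d)) = 0 := by
      have : (1 - d) * d = 0 := by rw [sub_mul, hd, one_mul, sub_self]
      rw [mul_assoc (d * u), ← mul_assoc (1 - d), ← mul_assoc (1 - d), this]; simp
    rw [add_mul, mul_sub (d * u * (1 - d)) 1, this]; simp, by
    have : d * u * (1 - d) * (d * u * (1 - d)) = 0 := by
      have : (1 - d) * d = 0 := by rw [sub_mul, hd, one_mul, sub_self]
      rw [mul_assoc (d * u), ← mul_assoc (1 - d), ← mul_assoc (1 - d), this]; simp
    rw [sub_mul, mul_add (d * u * (1 - d)) 1, this]; simp⟩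
  have ha' : a = 1 - d + m := by rw [← ha]; abel
  have hwa : ↑w * (a + d * v * b) = 1 - d + (m + d - d * u * m) := by
    have hvb : d * v * b = d - d * u * (1 - d) - d * u * m := by
      rw [mul_assoc, eq_sub_of_add_eq' huv, ha']; noncomm_ring
    change (1 + d * u * (1 - d)) * _ = _
    have h1 : (1 - d) * (1 - d) = 1 - d := IsIdempotentElem.one_sub hd
    have h2 : (1 - d) * m = 0 := by rw [sub_mul, one_mul, hdm, sub_self]
    have h3 : (1 - d) * (d * v * b) = 0 := by
      rw [← mul_assoc, ← mul_assoc, sub_mul, one_mul, hdd]; simp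
    have h4 : (1 - d) * (a + d * v * b) = 1 - d := by
      rw [ha', mul_add, mul_add, h1, h2, h3]; simp
    rw [add_mul, mul_assoc (d * u), h4, one_mul, hvb, ha']; abel
  obtain ⟨a', ha3⟩ : ∃ a', a' = ↑w * (a + d * v * b) := ⟨_, rfl⟩
  have ham : a + d * v * b = ↑w⁻¹ * a' := by rw [ha3, Units.inv_mul_cancel_left]
  rw [← ha3] at hwa
  have hda' : d * a' = m + d - d * u * m := by
    simp only [hwa, mul_add, mul_sub, mul_one, hdm, hdd, ← mul_assoc]
    simp
  have had' : a' * d = m + d - d * u * m := by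
    simp only [hwa, add_mul, sub_mul, one_mul, hdd, mul_assoc, hmd]
    simp
  have hk : d * a' * k = k := by
    rw [hda', sub_mul, add_mul, mul_assoc (d * u), hmk, hdk]; simp
  obtain ⟨n', hn', hg', hnil'⟩ := hF (d * a')
  have hg0' : d * a' * n' ≠ 0 := by
    intro h0
    rw [h0, sub_zero, mul_one] at hnil'
    obtain ⟨N, hN⟩ := hnil'
    have : ∀ N : ℕ, (d * a') ^ N * k = k := by
      intro N
      induction N with
      | zero => simp
      | succ N ih => rw [pow_succ, mul_assoc, hk, ih]
    apply hk0
    rw [← this N, hN, zero_mul]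
  obtain ⟨z, hz⟩ := exists_isUnit_add_mul_of_drazin_ne_zero (u := u * ↑w⁻¹) (v := v - u * d * v)
    hd IH (hda'.trans had'.symm) (by rw [hda', hwa]; abel)
    (by rw [mul_assoc, ← ham, ← huv]; noncomm_ring) (hn' _ (Commute.refl _)).symm hg' hg0'
  refine ⟨d * v + ↑w⁻¹ * z, ?_⟩
  have := w⁻¹.isUnit.mul hz
  rwa [mul_add, ← ham, ← mul_assoc, add_assoc, ← add_mul] at this

/-! ### Gluing along idempotents, and central units. -/

/-- This replaces a decomposition of A into local factors. The elements fixed by an idempotent all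
of whose idempotent multiples satisfy Q form an ideal. Were it inside a maximal m, the a given by
`hloc` would have its Fitting idempotent a b in m; since a (1 - a b) is nilpotent, a itself would
lie in m. -/
theorem idempotent_cover {A : Type*} [CommRing A] (hA : HasFitting A) {Q : A → Prop} (h0 : Q 0)
    (hadd : ∀ f g, IsIdempotentElem f → IsIdempotentElem g → f * g = 0 → Q f → Q g → Q (f + g))
    (hloc : ∀ m : Ideal A, m.IsMaximal → ∃ a, a ∉ m ∧ ∀ f, IsIdempotentElem f → a ∣ f → Q f) :
    Q 1 := by
  let I : Ideal A :=
    { carrier := {a | ∃ f, IsIdempotentElem f ∧ (∀ g, IsIdempotentElem g → f ∣ g → Q g) ∧ f * a = a}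
      zero_mem' := ⟨0, IsIdempotentElem.zero, fun g _ h => by rwa [zero_dvd_iff.1 h], by simp⟩
      add_mem' := by
        rintro a b ⟨f, hf, hQf, ha⟩ ⟨g, hg, hQg, hb⟩
        have hff : f * f = f := hf
        have hgg : g * g = g := hg
        -- The join of f and g; each idempotent multiple e splits orthogonally as f e + (1 - f) g e.
        refine ⟨f + (1 - f) * g, ?_, fun e he hdvd => ?_, ?_⟩
        · rw [IsIdempotentElem]; grind
        · obtain ⟨s, hs⟩ := hdvd
          have hee : e * e = e := he
          have h1 : e = f * e + (1 - f) * g * e := by grind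
          rw [h1]
          refine hadd _ _ ?_ ?_ ?_ (hQf _ ?_ ⟨e, rfl⟩) (hQg _ ?_ ⟨(1 - f) * e, by ring⟩)
          · rw [IsIdempotentElem]; grind
          · rw [IsIdempotentElem]; grind
          · grind
          · rw [IsIdempotentElem]; grind
          · rw [IsIdempotentElem]; grind
        · grind
      smul_mem' := by
        rintro c a ⟨f, hf, hQf, ha⟩
        exact ⟨f, hf, hQf, by rw [smul_eq_mul, mul_left_comm, ha]⟩ }
  have hI : I = ⊤ := by
    by_contra hne
    obtain ⟨m, hm, hIm⟩ := Ideal.exists_le_maximal I hne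
    obtain ⟨a, ha, hQ⟩ := hloc m hm
    obtain ⟨b, -, he, k, hk⟩ := hA a
    have h1 : a * b ∈ m :=
      hIm ⟨a * b, he, fun g hg hd => hQ g hg ((Dvd.intro _ rfl).trans hd), he⟩
    have h2 : a * (1 - a * b) ∈ m := hm.isPrime.mem_of_pow_mem k (hk ▸ m.zero_mem)
    have h3 : a = a * (1 - a * b) + a * (a * b) := by ring
    exact ha (h3 ▸ m.add_mem h2 (m.mul_mem_left a h1))
  obtain ⟨f, -, hQ, h1⟩ : (1 : A) ∈ I := hI ▸ Submodule.mem_top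
  rw [mul_one] at h1
  subst h1
  exact hQ 1 IsIdempotentElem.one dvd_rfl

theorem HasFitting.subring {R : Type*} [Ring R] (hF : HasFitting R) (S : Subring R)
    (hS : ∀ a ∈ S, ∀ b, (∀ s, Commute a s → Commute b s) → b ∈ S) : HasFitting S := by
  rintro ⟨a, ha⟩
  obtain ⟨b, hb, he, k, hk⟩ := hF a
  refine ⟨⟨b, hS a ha b hb⟩, fun s hs => ?_, Subtype.ext he, k, Subtype.ext hk⟩
  exact Subtype.ext (hb s (congrArg Subtype.val hs))

/-- The bicommutant of an element. -/
abbrev bicommutant {R : Type*} [Ring R] (a : R) : Subring R :=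
  Subring.centralizer (Subring.centralizer {a} : Set R)

instance bicommutant.instCommRing {R : Type*} [Ring R] (a : R) : CommRing (bicommutant a) :=
  { (bicommutant a).toRing with
    mul_comm := fun x y => Subtype.ext <|
      Set.centralizer_centralizer_comm_of_comm (S := {a}) (by rintro _ rfl _ rfl; rfl)
        x x.2 y y.2 }

theorem self_mem_bicommutant {R : Type*} [Ring R] (a : R) : a ∈ bicommutant a :=
  fun _ hg => (hg a rfl).symm

theorem center_le_bicommutant {R : Type*} [Ring R] (a : R) : Subring.center R ≤ bicommutant a :=
  Subring.center_le_centralizer _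

theorem HasFitting.bicommutant {R : Type*} [Ring R] (hF : HasFitting R) (a : R) :
    HasFitting (bicommutant a) :=
  hF.subring _ fun _ hc _ hb g hg => (hb g (hc g hg).symm).symm

theorem HasFitting.center {R : Type*} [Ring R] (hF : HasFitting R) :
    HasFitting (Subring.center R) :=
  hF.subring _ fun _ hc _ hb => Subring.mem_center_iff.2 fun g =>
    (hb g (Subring.mem_center_iff.1 hc g).symm).symm

theorem exists_isUnit_sub_of_card_lt {A : Type*} [CommRing A] (hA : HasFitting A) {k : ℕ}
    (hres : ∀ m : Ideal A, m.IsMaximal → k + 1 ≤ ENat.card (A ⧸ m)) (t : Fin k → A) :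
    ∃ x, ∀ i, IsUnit (x - t i) := by
  suffices h : ∃ x, ∀ i, ∃ s, (x - t i) * s = 1 by
    obtain ⟨x, hx⟩ := h
    exact ⟨x, fun i => (hx i).elim fun s hs => .of_mul_eq_one _ hs⟩
  refine idempotent_cover hA (Q := fun f => ∃ x, ∀ i, ∃ s, (x - t i) * s = f)
    ⟨0, fun i => ⟨0, mul_zero _⟩⟩ ?_ ?_
  · rintro f g hf hg hfg ⟨x, hx⟩ ⟨y, hy⟩
    refine ⟨f * x + (1 - f) * y, fun i => ?_⟩
    obtain ⟨r, hr⟩ := hx i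
    obtain ⟨s, hs⟩ := hy i
    have hff : f * f = f := hf
    exact ⟨f * r + (1 - f) * s, by grind⟩
  · intro m hm
    obtain ⟨x, hx⟩ : ∃ x : A ⧸ m, ∀ i, x ≠ Ideal.Quotient.mk m (t i) := by
      by_contra! hcon
      have hsurj : Function.Surjective fun i => Ideal.Quotient.mk m (t i) := fun x =>
        (hcon x).imp fun _ h => h.symm
      have : Finite (A ⧸ m) := Finite.of_surjective _ hsurj
      have h1 := hres m hm
      rw [ENat.card_eq_coe_natCard] at h1
      have h2 := Nat.card_le_card_of_surjective _ hsurj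
      rw [Nat.card_fin] at h2
      have h3 : k + 1 ≤ Nat.card (A ⧸ m) := by exact_mod_cast h1
      omega
    obtain ⟨x, rfl⟩ := Ideal.Quotient.mk_surjective x
    -- An idempotent divisible by the product is divisible by each factor, so every x - t i is
    -- invertible on it.
    refine ⟨∏ i, (x - t i), fun h => ?_, ?_⟩
    · obtain ⟨i, -, hi⟩ := (hm.isPrime.prod_mem_iff).1 h
      exact hx i (Ideal.Quotient.eq.2 hi)
    · rintro f - ⟨s, rfl⟩
      refine ⟨x, fun i => ?_⟩
      obtain ⟨r, hr⟩ := Finset.dvd_prod_of_mem (fun i => x - t i) (Finset.mem_univ i)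
      exact ⟨r * s, by rw [hr, mul_assoc]⟩

theorem exists_pairwise_isUnit_sub {A : Type*} [CommRing A] (hA : HasFitting A) {k : ℕ}
    (hres : ∀ m : Ideal A, m.IsMaximal → k ≤ ENat.card (A ⧸ m)) :
    ∃ t : Fin k → A, ∀ i j, i ≠ j → IsUnit (t i - t j) := by
  induction k with
  | zero => exact ⟨Fin.elim0, fun i => i.elim0⟩
  | succ k ih =>
    obtain ⟨t, ht⟩ := ih fun m hm => le_trans (by exact_mod_cast Nat.le_succ k) (hres m hm)
    obtain ⟨x, hx⟩ := exists_isUnit_sub_of_card_lt hA (by exact_mod_cast hres) t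
    refine ⟨Fin.cons x t, fun i j hij => ?_⟩
    induction i using Fin.cases with
    | zero =>
      induction j using Fin.cases with
      | zero => exact absurd rfl hij
      | succ j => simpa using hx j
    | succ i =>
      induction j using Fin.cases with
      | zero => simpa using (hx i).neg
      | succ j => simpa using ht i j fun h => hij (h ▸ rfl)

/-- A family of six central units, beginning with `1`, whose pairwise differences are units. -/
structure CentralUnits (R : Type*) [Ring R] where
  val : Fin 6 → Subring.center R
  isUnit : ∀ i, IsUnit (val i)
  isUnit_sub : ∀ i j, i ≠ j → IsUnit (val i - val j)
  zero : val 0 = 1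

theorem exists_centralUnits {R : Type*} [Ring R] (hF : HasFitting R)
    (hres : ∀ m : Ideal (Subring.center R), m.IsMaximal →
      7 ≤ ENat.card (Subring.center R ⧸ m)) : Nonempty (CentralUnits R) := by
  obtain ⟨t, ht⟩ := exists_pairwise_isUnit_sub hF.center (k := 7) (by exact_mod_cast hres)
  obtain ⟨u, hu⟩ := ht 1 0 (by decide)
  -- Of seven elements with unit differences, one is translated to 0 and the next rescaled to 1; the
  -- six nonzero ones remain.
  refine ⟨⟨fun i => ↑u⁻¹ * (t i.succ - t 0), fun i => ?_, fun i j hij => ?_, ?_⟩⟩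
  · exact u⁻¹.isUnit.mul (ht _ _ (Fin.succ_ne_zero i))
  · rw [← mul_sub, sub_sub_sub_cancel_right]
    exact u⁻¹.isUnit.mul (ht _ _ fun h => hij (Fin.succ_injective _ h))
  · change ↑u⁻¹ * (t 1 - t 0) = 1
    rw [← hu, Units.inv_mul]

/-- The central units, as elements of a bicommutant. -/
def CentralUnits.toBicommutant {R : Type*} [Ring R] (T : CentralUnits R) (a : R) (i : Fin 6) :
    bicommutant a :=
  Subring.inclusion (center_le_bicommutant a) (T.val i)

theorem isUnit_mul_add_one_sub {A : Type*} [CommRing A] {f x : A} (hf : IsIdempotentElem f)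
    (h : x ∣ f) : IsUnit (f * x + (1 - f)) := by
  obtain ⟨s, hs⟩ := h
  have hff : f * f = f := hf
  exact .of_mul_eq_one (f * s + (1 - f)) (by grind)

/-- Modulo a maximal ideal of the bicommutant, a differs from t 0 or from t 1. So locally a is a
unit plus a unit, up to idempotents, which are themselves differences of units. -/
theorem CentralUnits.mem_closure_isUnit {R : Type*} [Ring R] (T : CentralUnits R)
    (hF : HasFitting R) (a : R) : a ∈ AddSubgroup.closure {u : R | IsUnit u} := by
  obtain ⟨ι, hι⟩ : ∃ ι : bicommutant a →+* R, ι = (bicommutant a).subtype := ⟨_, rfl⟩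
  obtain ⟨α, hα⟩ : ∃ α : bicommutant a, ι α = a := ⟨⟨a, self_mem_bicommutant a⟩, by rw [hι]; rfl⟩
  have hS : ∀ x, IsUnit x → ι x ∈ AddSubgroup.closure {u : R | IsUnit u} := fun x hx =>
    AddSubgroup.subset_closure (hx.map ι)
  let t := T.toBicommutant a
  have ht : ∀ i, IsUnit (t i) := fun i => (T.isUnit i).map (Subring.inclusion _)
  have hts : ∀ i j, i ≠ j → IsUnit (t i - t j) := fun i j hij => by
    have := (T.isUnit_sub i j hij).map (Subring.inclusion (center_le_bicommutant a))
    rwa [map_sub] at this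
  have ht0 : t 0 = 1 := by
    change Subring.inclusion _ _ = _
    rw [T.zero, map_one]
  have hidem : ∀ g : bicommutant a, IsIdempotentElem g →
      ι g ∈ AddSubgroup.closure {u : R | IsUnit u} := by
    intro g hg
    obtain ⟨c, hc⟩ := hts 1 0 (by decide)
    have hu := isUnit_mul_add_one_sub hg (x := t 1) ((ht 1).dvd)
    -- With c = t 1 - 1, the unit g t 1 + (1 - g) equals 1 + g c.
    have : g = ↑c⁻¹ * (g * t 1 + (1 - g)) - ↑c⁻¹ := by
      have h1 : (g * t 1 + (1 - g)) = g * ↑c + 1 := by rw [hc, ht0]; ring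
      have h2 : (↑c⁻¹ : bicommutant a) * ↑c = 1 := c.inv_mul
      rw [h1]; linear_combination -g * h2
    rw [this, map_sub]
    exact AddSubgroup.sub_mem _ (hS _ (c⁻¹.isUnit.mul hu)) (hS _ c⁻¹.isUnit)
  have := idempotent_cover (hF.bicommutant a)
    (Q := fun f => ι (f * α) ∈ AddSubgroup.closure {u : R | IsUnit u}) ?_ ?_ ?_
  · simpa [hα] using this
  · simp
  · intro f g _ _ _ h1 h2
    simp only [add_mul, map_add]
    exact AddSubgroup.add_mem _ h1 h2
  · intro m hm
    obtain ⟨i, hi⟩ : ∃ i, α - t i ∉ m := by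
      by_contra! hcon
      have h1 := m.sub_mem (hcon 1) (hcon 0)
      rw [sub_sub_sub_cancel_left] at h1
      exact hm.ne_top (m.eq_top_of_isUnit_mem h1 (hts 0 1 (by decide)))
    refine ⟨_, hi, fun f hf hdvd => ?_⟩
    have h1 := hS _ (isUnit_mul_add_one_sub hf hdvd)
    have h2 := hS _ (isUnit_mul_add_one_sub hf (x := t i) (ht i).dvd)
    have h3 := hidem _ hf.one_sub
    have : f * α = (f * (α - t i) + (1 - f)) + (f * t i + (1 - f)) - (1 - f) - (1 - f) := by ring
    rw [this]
    simp only [map_sub ι _ (1 - f), map_add ι (f * (α - t i) + (1 - f))]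
    exact sub_mem (sub_mem (add_mem h1 h2) h3) h3

/-! ### Transvections, diagonal matrices and net subgroups. -/

section elementary
open Matrix

variable {n : ℕ} {R : Type*} [Ring R]

theorem single_mul_single_of_ne' {i j k l : Fin n} (h : j ≠ k) (x y : R) :
    single i j x * single k l y = 0 := single_mul_single_of_ne x i j k h y

theorem single_sub' (i j : Fin n) (x y : R) : single i j (x - y) = single i j x - single i j y := by
  rw [eq_sub_iff_add_eq, ← single_add, sub_add_cancel]

/-- The elementary transvection with off-diagonal entry `x` at `(i, j)`. -/
def elemGL {i j : Fin n} (h : i ≠ j) (x : R) : GeneralLinearGroup (Fin n) R where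
  val := 1 + single i j x
  inv := 1 - single i j x
  val_inv := by simp [add_mul, mul_sub, single_mul_single_of_ne' h.symm]
  inv_val := by simp [sub_mul, mul_add, single_mul_single_of_ne' h.symm]

theorem coe_elemGL {i j : Fin n} (h : i ≠ j) (x : R) :
    (elemGL h x : Matrix (Fin n) (Fin n) R) = 1 + single i j x := rfl

theorem coe_inv_elemGL {i j : Fin n} (h : i ≠ j) (x : R) :
    ((elemGL h x)⁻¹ : GeneralLinearGroup (Fin n) R).val = 1 - single i j x := rfl

/-- The diagonal matrix with entry `u` at `(k, k)` and `1` elsewhere. -/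
def diagGL (k : Fin n) (u : Rˣ) : GeneralLinearGroup (Fin n) R where
  val := 1 + single k k (u - 1 : R)
  inv := 1 + single k k (↑u⁻¹ - 1 : R)
  val_inv := by
    simp only [add_mul, mul_add, one_mul, mul_one, single_mul_single_same, add_assoc, ← single_add]
    rw [add_eq_left, ← single_zero k k]; congr 1; simp [sub_mul, mul_sub]; abel
  inv_val := by
    simp only [add_mul, mul_add, one_mul, mul_one, single_mul_single_same, add_assoc, ← single_add]
    rw [add_eq_left, ← single_zero k k]; congr 1; simp [sub_mul, mul_sub]; abel

theorem coe_diagGL (k : Fin n) (u : Rˣ) :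
    (diagGL k u : Matrix (Fin n) (Fin n) R) = 1 + single k k (u - 1 : R) := rfl

theorem mem_diagonalSubgroup_of_eq_diagonal {g : GeneralLinearGroup (Fin n) R} {d : Fin n → R}
    (hd : ∀ i, IsUnit (d i)) (hg : (g : Matrix (Fin n) (Fin n) R) = diagonal d) :
    g ∈ diagonalSubgroup n R :=
  ⟨MulEquiv.piUnits.symm fun i => (hd i).unit, Units.ext hg.symm⟩

theorem diagGL_mem_diagonalSubgroup (k : Fin n) (u : Rˣ) : diagGL k u ∈ diagonalSubgroup n R := by
  refine mem_diagonalSubgroup_of_eq_diagonal (d := fun i => if i = k then u else 1) (fun i => ?_) ?_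
  · split
    · exact u.isUnit
    · exact isUnit_one
  · rw [coe_diagGL]
    ext i j
    rw [Matrix.add_apply, single_apply, diagonal_apply, one_apply]
    grind

theorem elemGL_zero {i j : Fin n} (h : i ≠ j) : elemGL h (0 : R) = 1 :=
  Units.ext (by simp [coe_elemGL])

theorem elemGL_mul {i j : Fin n} (h : i ≠ j) (x y : R) :
    elemGL h x * elemGL h y = elemGL h (x + y) :=
  Units.ext (by
    simp only [Units.val_mul, coe_elemGL, add_mul, mul_add, one_mul, mul_one,
      single_mul_single_of_ne' h.symm, single_add]
    abel)

theorem elemGL_inv {i j : Fin n} (h : i ≠ j) (x : R) : (elemGL h x)⁻¹ = elemGL h (-x) :=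
  Units.ext (by rw [coe_inv_elemGL, coe_elemGL, ← zero_sub, single_sub', single_zero]; abel)

theorem diagGL_mul_elemGL_left {i j : Fin n} (h : i ≠ j) (u : Rˣ) (x : R) :
    diagGL i u * elemGL h x = elemGL h (u * x) * diagGL i u :=
  Units.ext (by
    simp only [Units.val_mul, coe_elemGL, coe_diagGL, add_mul, mul_add, one_mul, mul_one,
      single_mul_single_of_ne' h.symm, single_mul_single_same, sub_mul, mul_sub, single_sub',
      add_zero]
    abel)

theorem elemGL_mul_diagGL_right {i j : Fin n} (h : i ≠ j) (u : Rˣ) (x : R) :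
    elemGL h x * diagGL j u = diagGL j u * elemGL h (x * u) :=
  Units.ext (by
    simp only [Units.val_mul, coe_elemGL, coe_diagGL, add_mul, mul_add, one_mul, mul_one,
      single_mul_single_of_ne' h.symm, single_mul_single_same, sub_mul, mul_sub, single_sub', sub_zero,
      add_zero]
    abel)

theorem elemGL_mul_elemGL {i r j : Fin n} (hir : i ≠ r) (hrj : r ≠ j) (hij : i ≠ j) (a b : R) :
    elemGL hir a * elemGL hrj b = elemGL hij (a * b) * elemGL hrj b * elemGL hir a :=
  Units.ext (by
    simp only [Units.val_mul, coe_elemGL, add_mul, mul_add, one_mul, mul_one,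
      single_mul_single_of_ne' hij.symm,
      single_mul_single_of_ne' hrj.symm, single_mul_single_same, add_zero]
    abel)

theorem GeneralLinearGroup.sum_mul_inv_apply (a : GeneralLinearGroup (Fin n) R) (i j : Fin n) :
    ∑ r, a i r * (a⁻¹).val r j = (1 : Matrix (Fin n) (Fin n) R) i j := by
  rw [← Matrix.mul_apply, Units.mul_inv]

theorem GeneralLinearGroup.sum_inv_mul_apply (a : GeneralLinearGroup (Fin n) R) (i j : Fin n) :
    ∑ r, (a⁻¹).val i r * a r j = (1 : Matrix (Fin n) (Fin n) R) i j := by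
  rw [← Matrix.mul_apply, Units.inv_mul]

namespace DNet

variable (σ : DNet n R)

theorem ext_of_ne {σ τ : DNet n R} (h : ∀ i j, i ≠ j → σ.ideal i j = τ.ideal i j) : σ = τ := by
  obtain ⟨s, h1, h2⟩ := σ
  obtain ⟨t, h3, h4⟩ := τ
  obtain rfl : s = t := by
    funext i j
    by_cases hij : i = j
    · subst hij
      rw [h2, h4]
    · exact h i j hij
  rfl

theorem add_mem_matrices {a b : Matrix (Fin n) (Fin n) R} (ha : a ∈ σ.matrices)
    (hb : b ∈ σ.matrices) : a + b ∈ σ.matrices := fun i j => add_mem (ha i j) (hb i j)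

theorem single_mem_matrices {i j : Fin n} {x : R} (hx : x ∈ σ.ideal i j) :
    single i j x ∈ σ.matrices := by
  intro i' j'
  rw [single_apply]
  split
  · next h => rw [← h.1, ← h.2]; exact hx
  · exact zero_mem _

theorem elemGL_mem_netSubgroup {i j : Fin n} (h : i ≠ j) {x : R} (hx : x ∈ σ.ideal i j) :
    elemGL h x ∈ σ.netSubgroup := by
  refine ⟨σ.add_mem_matrices σ.one_mem_matrices (σ.single_mem_matrices hx), ?_⟩
  rw [elemGL_inv]
  exact σ.add_mem_matrices σ.one_mem_matrices (σ.single_mem_matrices (neg_mem hx))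

theorem diagonalSubgroup_le_netSubgroup : diagonalSubgroup n R ≤ σ.netSubgroup := by
  refine σ.isGreatest_netSubgroup.2 ?_
  rintro _ ⟨d, rfl⟩ i j
  change diagonal (d : Fin n → R) i j ∈ _
  by_cases hij : i = j
  · subst hij
    rw [σ.diag]
    trivial
  · rw [diagonal_apply_ne _ hij]
    exact zero_mem _

/-- Since v k = 0, products of distinct off-diagonal units of row k vanish, so multiplying
transvections adds their entries. -/
theorem exists_row_mem {H : Subgroup (GeneralLinearGroup (Fin n) R)}
    (hE : ∀ i j (h : i ≠ j), ∀ x ∈ σ.ideal i j, elemGL h x ∈ H) (k : Fin n) (v : Fin n → R)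
    (hvk : v k = 0) (hv : ∀ l, v l ∈ σ.ideal k l) :
    ∃ g ∈ H ⊓ σ.netSubgroup, (g : Matrix (Fin n) (Fin n) R) = 1 + ∑ l, single k l (v l) := by
  suffices h : ∀ T : Finset (Fin n), ∃ g ∈ H ⊓ σ.netSubgroup,
      (g : Matrix (Fin n) (Fin n) R) = 1 + ∑ l ∈ T, single k l (v l) from h Finset.univ
  intro T
  induction T using Finset.induction_on with
  | empty => exact ⟨1, one_mem _, by simp⟩
  | insert l T hl ih =>
    obtain ⟨g, hg, hgv⟩ := ih
    rw [Finset.sum_insert hl]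
    by_cases hkl : k = l
    · subst hkl
      exact ⟨g, hg, by rw [hgv, hvk, single_zero, zero_add]⟩
    · refine ⟨g * elemGL hkl (v l), Subgroup.mul_mem _ hg (Subgroup.mem_inf.2 ⟨hE _ _ hkl _ (hv l),
        σ.elemGL_mem_netSubgroup hkl (hv l)⟩), ?_⟩
      rw [Units.val_mul, hgv, coe_elemGL, mul_add, add_mul _ _ (single k l (v l)), one_mul, mul_one,
        Finset.sum_mul, Finset.sum_eq_zero (s := T) (f := fun i => _ * _), add_zero]
      · abel
      · intro x _
        by_cases hxk : x = k
        · rw [hxk, hvk, single_zero, zero_mul]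
        · rw [single_mul_single_of_ne' hxk]

theorem exists_col_mem {H : Subgroup (GeneralLinearGroup (Fin n) R)}
    (hE : ∀ i j (h : i ≠ j), ∀ x ∈ σ.ideal i j, elemGL h x ∈ H) (k : Fin n) (v : Fin n → R)
    (hvk : v k = 0) (hv : ∀ l, v l ∈ σ.ideal l k) :
    ∃ g ∈ H ⊓ σ.netSubgroup, (g : Matrix (Fin n) (Fin n) R) = 1 + ∑ l, single l k (v l) := by
  suffices h : ∀ T : Finset (Fin n), ∃ g ∈ H ⊓ σ.netSubgroup,
      (g : Matrix (Fin n) (Fin n) R) = 1 + ∑ l ∈ T, single l k (v l) from h Finset.univ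
  intro T
  induction T using Finset.induction_on with
  | empty => exact ⟨1, one_mem _, by simp⟩
  | insert l T hl ih =>
    obtain ⟨g, hg, hgv⟩ := ih
    rw [Finset.sum_insert hl]
    by_cases hkl : l = k
    · subst hkl
      exact ⟨g, hg, by rw [hgv, hvk, single_zero, zero_add]⟩
    · refine ⟨g * elemGL hkl (v l), Subgroup.mul_mem _ hg (Subgroup.mem_inf.2 ⟨hE _ _ hkl _ (hv l),
        σ.elemGL_mem_netSubgroup hkl (hv l)⟩), ?_⟩
      rw [Units.val_mul, hgv, coe_elemGL, mul_add, add_mul _ _ (single l k (v l)), one_mul, mul_one,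
        Finset.sum_mul, Finset.sum_eq_zero (s := T) (f := fun i => _ * _), add_zero]
      · abel
      · intro x _
        rw [single_mul_single_of_ne' (Ne.symm hkl)]

end DNet
end elementary

/-! ### Gaussian elimination inside a net subgroup. -/

section elimination
open Matrix

variable {n : ℕ} {R : Type*} [Ring R]

namespace DNet

/-- The net obtained from `σ` by replacing with `0` the off-diagonal ideals in the rows and columns
with index in `S`. -/
def isolate (σ : DNet n R) (S : Finset (Fin n)) : DNet n R where
  ideal i j := if i ≠ j ∧ (i ∈ S ∨ j ∈ S) then ⊥ else σ.ideal i j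
  mul_mem i r j a b ha hb := by
    have key : ∀ i j (x : R), (i ≠ j ∧ (i ∈ S ∨ j ∈ S)) →
        x ∈ (if i ≠ j ∧ (i ∈ S ∨ j ∈ S) then ⊥ else σ.ideal i j) → x = 0 := fun i j x h hx => by
      rwa [if_pos h, TwoSidedIdeal.mem_bot] at hx
    by_cases h1 : i ≠ r ∧ (i ∈ S ∨ r ∈ S)
    · rw [key i r a h1 ha, zero_mul]; exact zero_mem _
    by_cases h2 : r ≠ j ∧ (r ∈ S ∨ j ∈ S)
    · rw [key r j b h2 hb, mul_zero]; exact zero_mem _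
    rw [if_neg h1] at ha
    rw [if_neg h2] at hb
    rw [if_neg]
    · exact σ.mul_mem i r j a b ha hb
    · rintro ⟨hij, h⟩
      by_cases hir : i = r
      · subst hir; exact h2 ⟨hij, h⟩
      · by_cases hrj : r = j
        · subst hrj; exact h1 ⟨hij, h⟩
        · exact h.elim (fun h => h1 ⟨hir, .inl h⟩) fun h => h2 ⟨hrj, .inr h⟩
  diag i := by simp [σ.diag]

theorem isolate_le (σ : DNet n R) (S : Finset (Fin n)) {i j : Fin n} {x : R}
    (hx : x ∈ (σ.isolate S).ideal i j) : x ∈ σ.ideal i j := by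
  change x ∈ ite _ _ _ at hx
  split_ifs at hx
  · rw [TwoSidedIdeal.mem_bot] at hx
    rw [hx]; exact zero_mem _
  · exact hx

theorem mem_isolate_insert {σ : DNet n R} {S : Finset (Fin n)} {k i j : Fin n} {x : R}
    (hx : x ∈ (σ.isolate S).ideal i j) (hk : i ≠ j → i = k ∨ j = k → x = 0) :
    x ∈ (σ.isolate (insert k S)).ideal i j := by
  change x ∈ ite _ _ _ at hx ⊢
  split_ifs at hx ⊢ with h1 h2 h3
  · exact hx
  · rw [TwoSidedIdeal.mem_bot]
    refine hk h1.1 ?_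
    simp only [Finset.mem_insert] at h1
    tauto
  · rw [TwoSidedIdeal.mem_bot] at hx
    rw [hx]; exact zero_mem _
  · exact hx

theorem mem_netSubgroup_isolate_insert {σ : DNet n R} {S : Finset (Fin n)} {k : Fin n}
    {g : GeneralLinearGroup (Fin n) R} (hg : g ∈ (σ.isolate S).netSubgroup)
    (hu : IsUnit (g k k)) (hrow : ∀ l, l ≠ k → g k l = 0) (hcol : ∀ l, l ≠ k → g l k = 0) :
    g ∈ (σ.isolate (insert k S)).netSubgroup := by
  have hrow' : ∀ l, l ≠ k → (g⁻¹).val k l = 0 := fun l hl => by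
    have h := GeneralLinearGroup.sum_mul_inv_apply g k l
    rw [Finset.sum_eq_single k (fun m _ hm => by rw [hrow m hm, zero_mul]) (by simp),
      one_apply_ne hl.symm] at h
    exact hu.mul_right_eq_zero.1 h
  have hcol' : ∀ l, l ≠ k → (g⁻¹).val l k = 0 := fun l hl => by
    have h := GeneralLinearGroup.sum_inv_mul_apply g l k
    rw [Finset.sum_eq_single k (fun m _ hm => by rw [hcol m hm, mul_zero]) (by simp),
      one_apply_ne hl] at h
    exact hu.mul_left_eq_zero.1 h
  refine ⟨fun i j => mem_isolate_insert (hg.1 i j) ?_, fun i j => mem_isolate_insert (hg.2 i j) ?_⟩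
  · rintro hij (rfl | rfl)
    · exact hrow j hij.symm
    · exact hcol i hij
  · rintro hij (rfl | rfl)
    · exact hrow' j hij.symm
    · exact hcol' i hij

theorem one_add_row_mul_apply (k : Fin n) (v : Fin n → R) (M : Matrix (Fin n) (Fin n) R)
    (j : Fin n) : ((1 + ∑ l, single k l (v l)) * M) k j = M k j + ∑ l, v l * M l j := by
  rw [add_mul, one_mul, Matrix.add_apply, Finset.sum_mul, Matrix.sum_apply]
  simp only [single_mul_apply_same]

theorem one_add_col_mul_apply (k i : Fin n) (v : Fin n → R) (M : Matrix (Fin n) (Fin n) R)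
    (j : Fin n) : ((1 + ∑ l, single l k (v l)) * M) i j = M i j + v i * M k j := by
  rw [add_mul, one_mul, Matrix.add_apply, Finset.sum_mul, Matrix.sum_apply,
    Finset.sum_eq_single i (fun m _ hm => by rw [single_mul_apply_of_ne _ _ _ _ _ hm.symm]) (by simp),
    single_mul_apply_same]

theorem mul_one_add_row_apply (k : Fin n) (v : Fin n → R) (M : Matrix (Fin n) (Fin n) R)
    (i j : Fin n) : (M * (1 + ∑ l, single k l (v l))) i j = M i j + M i k * v j := by
  rw [mul_add, mul_one, Matrix.add_apply, Finset.mul_sum, Matrix.sum_apply,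
    Finset.sum_eq_single j (fun m _ hm => by rw [mul_single_apply_of_ne _ _ _ _ _ hm.symm]) (by simp),
    mul_single_apply_same]

/-- Each step splits off one index k ∉ S: a row operation makes the (k, k) entry a unit, then column
k and row k are cleared. When S is everything, only diagonal matrices remain. -/
theorem netSubgroup_isolate_le (hF : HasFitting R) (hwf : WellFounded (IdemLT (R := R)))
    (σ : DNet n R) {H : Subgroup (GeneralLinearGroup (Fin n) R)}
    (hD : diagonalSubgroup n R ≤ H)
    (hE : ∀ i j (h : i ≠ j), ∀ x ∈ σ.ideal i j, elemGL h x ∈ H) (S : Finset (Fin n)) :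
    (σ.isolate S).netSubgroup ≤ H := by
  induction hd : Sᶜ.card generalizing S with
  | zero =>
    rw [Finset.card_eq_zero, Finset.compl_eq_empty_iff] at hd
    subst hd
    intro g hg
    have h0 : ∀ i j, i ≠ j → ∀ x ∈ (σ.isolate Finset.univ).ideal i j, x = 0 := fun i j hij x hx => by
      change x ∈ ite _ _ _ at hx
      rwa [if_pos ⟨hij, Or.inl (Finset.mem_univ i)⟩, TwoSidedIdeal.mem_bot] at hx
    refine hD (mem_diagonalSubgroup_of_eq_diagonal (d := fun i => g i i) (fun i => ?_) ?_)
    · refine ⟨⟨g i i, (g⁻¹).val i i, ?_, ?_⟩, rfl⟩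
      · have h := GeneralLinearGroup.sum_mul_inv_apply g i i
        rwa [Finset.sum_eq_single i (fun m _ hm => by rw [h0 _ _ hm.symm _ (hg.1 i m), zero_mul])
          (by simp), one_apply_eq] at h
      · have h := GeneralLinearGroup.sum_inv_mul_apply g i i
        rwa [Finset.sum_eq_single i (fun m _ hm => by rw [h0 _ _ hm _ (hg.1 m i), mul_zero])
          (by simp), one_apply_eq] at h
    · ext i j
      by_cases hij : i = j
      · subst hij; rw [diagonal_apply_eq]
      · rw [diagonal_apply_ne _ hij, h0 i j hij _ (hg.1 i j)]
  | succ d ih =>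
    intro g hg
    obtain ⟨k, hk⟩ : Sᶜ.Nonempty := Finset.card_pos.1 (by omega)
    have hkS : k ∉ S := Finset.mem_compl.1 hk
    have ih' : (σ.isolate (insert k S)).netSubgroup ≤ H := ih _ (by
      rw [Finset.compl_insert, Finset.card_erase_of_mem hk, hd]; rfl)
    have hE' : ∀ i j (h : i ≠ j), ∀ x ∈ (σ.isolate S).ideal i j, elemGL h x ∈ H :=
      fun i j h x hx => hE i j h x (σ.isolate_le S hx)
    have hins := fun g => mem_netSubgroup_isolate_insert (σ := σ) (S := S) (k := k) (g := g)
    obtain ⟨τ, hτ⟩ : ∃ τ, τ = σ.isolate S := ⟨_, rfl⟩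
    rw [← hτ] at hg hE' hins
    -- The (k, k) entry of g⁻¹ g = 1 is the unimodular relation. Using entries of g⁻¹ as
    -- coefficients keeps the row operation z (g⁻¹)_kl inside the net.
    obtain ⟨z, hz⟩ := exists_isUnit_add_mul hF hwf (a := g k k) (u := (g⁻¹).val k k) (v := 1)
      (b := ∑ l ∈ Finset.univ.erase k, (g⁻¹).val k l * g l k) (by
        rw [one_mul, Finset.add_sum_erase _ (fun l => (g⁻¹).val k l * g l k) (Finset.mem_univ k),
          GeneralLinearGroup.sum_inv_mul_apply, one_apply_eq])
    obtain ⟨p, hp, hpv⟩ := τ.exists_row_mem hE' k (fun l => if l = k then 0 else z * (g⁻¹).val k l)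
      (if_pos rfl) fun l => by
        split_ifs
        · exact zero_mem _
        · exact TwoSidedIdeal.mul_mem_left _ _ _ (hg.2 k l)
    have hpg : p * g ∈ τ.netSubgroup := Subgroup.mul_mem _ hp.2 hg
    have hkk : IsUnit ((p * g).val k k) := by
      rw [Units.val_mul, hpv, one_add_row_mul_apply]
      convert hz using 2
      rw [Finset.mul_sum, ← Finset.add_sum_erase _ _ (Finset.mem_univ k), if_pos rfl, zero_mul,
        zero_add]
      refine Finset.sum_congr rfl fun l hl => ?_
      rw [if_neg (Finset.ne_of_mem_erase hl), mul_assoc]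
    obtain ⟨w, hw⟩ := hkk
    obtain ⟨q, hq, hqv⟩ := τ.exists_col_mem hE' k
      (fun l => if l = k then 0 else -((p * g).val l k * ↑w⁻¹)) (if_pos rfl) fun l => by
        split_ifs
        · exact zero_mem _
        · exact neg_mem (TwoSidedIdeal.mul_mem_right _ _ _ (hpg.1 l k))
    have hqpg : q * (p * g) ∈ τ.netSubgroup := Subgroup.mul_mem _ hq.2 hpg
    have hcol : ∀ l, l ≠ k → (q * (p * g)).val l k = 0 := fun l hl => by
      rw [Units.val_mul, hqv, one_add_col_mul_apply, if_neg hl, ← hw, neg_mul, mul_assoc,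
        Units.inv_mul, mul_one, add_neg_cancel]
    have hqk : (q * (p * g)).val k k = ↑w := by
      rw [Units.val_mul, hqv, one_add_col_mul_apply, if_pos rfl, ← hw, zero_mul, add_zero]
    obtain ⟨r, hr, hrv⟩ := τ.exists_row_mem hE' k
      (fun l => if l = k then 0 else -(↑w⁻¹ * (q * (p * g)).val k l)) (if_pos rfl) fun l => by
        split_ifs
        · exact zero_mem _
        · exact neg_mem (TwoSidedIdeal.mul_mem_left _ _ _ (hqpg.1 k l))
    have hfin : q * (p * g) * r ∈ H := by
      refine ih' (hins _ (Subgroup.mul_mem _ hqpg hr.2) ?_ (fun l hl => ?_) fun l hl => ?_)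
      · rw [Units.val_mul, hrv, mul_one_add_row_apply, if_pos rfl, mul_zero, add_zero, hqk]
        exact w.isUnit
      · rw [Units.val_mul, hrv, mul_one_add_row_apply, if_neg hl, hqk, mul_neg,
          Units.mul_inv_cancel_left, add_neg_cancel]
      · rw [Units.val_mul, hrv, mul_one_add_row_apply, if_pos rfl, mul_zero, add_zero, hcol l hl]
    rwa [Subgroup.mul_mem_cancel_right _ hr.1, Subgroup.mul_mem_cancel_left _ hq.1,
      Subgroup.mul_mem_cancel_left _ hp.1] at hfin

theorem netSubgroup_le (hF : HasFitting R) (hwf : WellFounded (IdemLT (R := R)))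
    (σ : DNet n R) {H : Subgroup (GeneralLinearGroup (Fin n) R)}
    (hD : diagonalSubgroup n R ≤ H)
    (hE : ∀ i j (h : i ≠ j), ∀ x ∈ σ.ideal i j, elemGL h x ∈ H) : σ.netSubgroup ≤ H := by
  refine le_trans (fun g hg => ?_) (σ.netSubgroup_isolate_le hF hwf hD hE ∅)
  have h : ∀ i j, (σ.isolate ∅).ideal i j = σ.ideal i j := fun i j => if_neg (by simp)
  refine ⟨fun i j => ?_, fun i j => ?_⟩
  · rw [h]; exact hg.1 i j
  · rw [h]; exact hg.2 i j

end DNet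
end elimination

/-! ### Extracting transvections from elements of F. -/

section extraction
open Matrix

variable {n : ℕ} {R : Type*} [Ring R]

/-- Conjugation by `diagGL i u` multiplies the entry by u, and units generate R additively. -/
theorem elemGL_mul_left_mem {F : Subgroup (GeneralLinearGroup (Fin n) R)}
    (hD : diagonalSubgroup n R ≤ F) (hU : ∀ a : R, a ∈ AddSubgroup.closure {u : R | IsUnit u})
    {i j : Fin n} (h : i ≠ j) (w : R) {x : R} (hx : elemGL h x ∈ F) : elemGL h (w * x) ∈ F := by
  induction hU w using AddSubgroup.closure_induction with
  | mem u hu =>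
    obtain ⟨u, rfl⟩ := hu
    have h1 := F.mul_mem (hD (diagGL_mem_diagonalSubgroup i u)) hx
    rwa [diagGL_mul_elemGL_left,
      Subgroup.mul_mem_cancel_right _ (hD (diagGL_mem_diagonalSubgroup i u))] at h1
  | zero => rw [zero_mul, elemGL_zero]; exact one_mem _
  | add a b _ _ ha hb => rw [add_mul, ← elemGL_mul]; exact mul_mem ha hb
  | neg a _ ha => rw [neg_mul, ← elemGL_inv]; exact inv_mem ha

theorem elemGL_mul_right_mem {F : Subgroup (GeneralLinearGroup (Fin n) R)}
    (hD : diagonalSubgroup n R ≤ F) (hU : ∀ a : R, a ∈ AddSubgroup.closure {u : R | IsUnit u})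
    {i j : Fin n} (h : i ≠ j) (w : R) {x : R} (hx : elemGL h x ∈ F) : elemGL h (x * w) ∈ F := by
  induction hU w using AddSubgroup.closure_induction with
  | mem u hu =>
    obtain ⟨u, rfl⟩ := hu
    have h1 := F.mul_mem hx (hD (diagGL_mem_diagonalSubgroup j u))
    rwa [elemGL_mul_diagGL_right,
      Subgroup.mul_mem_cancel_left _ (hD (diagGL_mem_diagonalSubgroup j u))] at h1
  | zero => rw [mul_zero, elemGL_zero]; exact one_mem _
  | add a b _ _ ha hb => rw [mul_add, ← elemGL_mul]; exact mul_mem ha hb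
  | neg a _ ha => rw [mul_neg, ← elemGL_inv]; exact inv_mem ha

/-- The net of a subgroup `F` that contains the invertible diagonal matrices: off the diagonal, its
`(i, j)` ideal consists of the `x` whose elementary transvection at `(i, j)` lies in `F`. -/
def DNet.ofSubgroup (F : Subgroup (GeneralLinearGroup (Fin n) R)) (hD : diagonalSubgroup n R ≤ F)
    (hU : ∀ a : R, a ∈ AddSubgroup.closure {u : R | IsUnit u}) : DNet n R where
  ideal i j := TwoSidedIdeal.mk' {x | ∀ h : i ≠ j, elemGL h x ∈ F}
    (fun h => by rw [elemGL_zero]; exact one_mem _)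
    (fun hx hy h => by rw [← elemGL_mul]; exact F.mul_mem (hx h) (hy h))
    (fun hx h => by rw [← elemGL_inv]; exact F.inv_mem (hx h))
    (fun hy h => elemGL_mul_left_mem hD hU h _ (hy h))
    (fun hx h => elemGL_mul_right_mem hD hU h _ (hx h))
  mul_mem i r j a b ha hb := by
    rw [TwoSidedIdeal.mem_mk'] at ha hb ⊢
    intro hij
    by_cases hir : i = r
    · subst hir
      exact elemGL_mul_left_mem hD hU hij a (hb hij)
    by_cases hrj : r = j
    · subst hrj
      exact elemGL_mul_right_mem hD hU hij b (ha hij)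
    have h1 := F.mul_mem (ha hir) (hb hrj)
    rwa [elemGL_mul_elemGL hir hrj hij, Subgroup.mul_mem_cancel_right _ (ha hir),
      Subgroup.mul_mem_cancel_right _ (hb hrj)] at h1
  diag i := by
    ext x
    rw [TwoSidedIdeal.mem_mk']
    exact ⟨fun _ => trivial, fun _ h => absurd rfl h⟩

theorem DNet.mem_ofSubgroup {F : Subgroup (GeneralLinearGroup (Fin n) R)}
    {hD : diagonalSubgroup n R ≤ F} {hU : ∀ a : R, a ∈ AddSubgroup.closure {u : R | IsUnit u}}
    {i j : Fin n} {x : R} :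
    x ∈ (DNet.ofSubgroup F hD hU).ideal i j ↔ ∀ h : i ≠ j, elemGL h x ∈ F := by
  unfold DNet.ofSubgroup
  rw [TwoSidedIdeal.mem_mk']
  rfl

theorem elemGL_mem_of_isUnit_mul {F : Subgroup (GeneralLinearGroup (Fin n) R)}
    (hD : diagonalSubgroup n R ≤ F) (hU : ∀ a : R, a ∈ AddSubgroup.closure {u : R | IsUnit u})
    {i j : Fin n} (h : i ≠ j) {w x : R}
    (hw : IsUnit w) (hx : elemGL h (w * x) ∈ F) : elemGL h x ∈ F := by
  obtain ⟨w, rfl⟩ := hw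
  simpa using elemGL_mul_left_mem hD hU h (↑w⁻¹) hx

/-- A column that can be modified by diagonal matrices can be split into transvections. -/
theorem elemGL_mem_of_column {F : Subgroup (GeneralLinearGroup (Fin n) R)}
    (hD : diagonalSubgroup n R ≤ F) (hU : ∀ a : R, a ∈ AddSubgroup.closure {u : R | IsUnit u})
    {c : Rˣ} (hc1 : IsUnit (c - 1 : R))
    {k : Fin n} {h : GeneralLinearGroup (Fin n) R} (hh : h ∈ F)
    (hcol : ∀ l m, m ≠ k → h l m = (1 : Matrix (Fin n) (Fin n) R) l m) (hkk : h k k = 1)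
    {i : Fin n} (hik : i ≠ k) : elemGL hik (h i k) ∈ F := by
  have hrow : ∀ m, h k m = (1 : Matrix (Fin n) (Fin n) R) k m := fun m => by
    by_cases hm : m = k
    · rw [hm, hkk, one_apply_eq]
    · exact hcol k m hm
  have h1 : ∀ x : R, h.val * single i i x = single i i x := fun x => by
    ext l m
    by_cases hm : m = i
    · rw [hm, mul_single_apply_same, hcol l i hik, one_apply, single_apply]
      grind
    · rw [mul_single_apply_of_ne _ _ _ _ _ hm, single_apply_of_col_ne _ _ (Ne.symm hm)]
  have h2 : ∀ x : R, single i k x * h.val = single i k x := fun x => by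
    ext l m
    by_cases hl : l = i
    · rw [hl, single_mul_apply_same, hrow, one_apply, single_apply]
      grind
    · rw [single_mul_apply_of_ne _ _ _ _ _ hl, single_apply_of_row_ne (Ne.symm hl)]
  have h3 : ∀ x : R, single i i x * h.val = single i i x + single i k (x * h i k) := fun x => by
    ext l m
    by_cases hl : l = i
    · rw [hl, single_mul_apply_same, Matrix.add_apply, single_apply, single_apply]
      by_cases hm : m = k
      · subst hm; simp [hik]
      · rw [hcol i m hm, one_apply]
        grind
    · rw [single_mul_apply_of_ne _ _ _ _ _ hl, Matrix.add_apply,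
        single_apply_of_row_ne (Ne.symm hl), single_apply_of_row_ne (Ne.symm hl), add_zero]
  -- The commutator of `diagGL i c` with h is a single transvection, because h differs from 1 only
  -- in column k.
  have key : diagGL i c * h = elemGL hik ((c - 1 : R) * h i k) * h * diagGL i c := by
    refine Units.ext ?_
    simp only [Units.val_mul, coe_diagGL, coe_elemGL, add_mul, mul_add, one_mul, mul_one, h1, h2, h3,
      single_mul_single_of_ne' hik.symm, add_zero]
    abel
  have hd := hD (diagGL_mem_diagonalSubgroup i c)
  have h4 := F.mul_mem hd hh
  rw [key, Subgroup.mul_mem_cancel_right _ hd, Subgroup.mul_mem_cancel_right _ hh] at h4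
  exact elemGL_mem_of_isUnit_mul hD hU hik hc1 h4

/-- Row k of g⁻¹ also vanishes off the diagonal, so the commutator of g with `diagGL k c` differs
from 1 only in column k. Its (i, k) entry is g i k times a unit, as one-sided inverses are
two-sided. -/
theorem elemGL_mem_of_row_eq_zero {F : Subgroup (GeneralLinearGroup (Fin n) R)}
    (hF : HasFitting R)
    (hD : diagonalSubgroup n R ≤ F) (hU : ∀ a : R, a ∈ AddSubgroup.closure {u : R | IsUnit u})
    {c : Rˣ} (hc : ∀ x : R, c * x = x * c) (hc1 : IsUnit (c - 1 : R))
    {k : Fin n} {g : GeneralLinearGroup (Fin n) R} (hg : g ∈ F) (hrow : ∀ m, m ≠ k → g k m = 0)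
    {i : Fin n} (hik : i ≠ k) : elemGL hik (g i k) ∈ F := by
  have hgk : g k k * (g⁻¹).val k k = 1 := by
    have h := GeneralLinearGroup.sum_mul_inv_apply g k k
    rwa [Finset.sum_eq_single k (fun m _ hm => by rw [hrow m hm, zero_mul]) (by simp),
      one_apply_eq] at h
  have hgk' := hF.mul_eq_one_symm hgk
  have hrow' : ∀ l, l ≠ k → (g⁻¹).val k l = 0 := fun l hl => by
    have h := GeneralLinearGroup.sum_mul_inv_apply g k l
    rw [Finset.sum_eq_single k (fun m _ hm => by rw [hrow m hm, zero_mul]) (by simp),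
      one_apply_ne hl.symm] at h
    rw [← one_mul ((g⁻¹).val k l), ← hgk', mul_assoc, h, mul_zero]
  have hd := hD (diagGL_mem_diagonalSubgroup k c)
  have hd' := hD (diagGL_mem_diagonalSubgroup k c⁻¹)
  obtain ⟨h, hh⟩ : ∃ h, h = g * diagGL k c * g⁻¹ * diagGL k c⁻¹ := ⟨_, rfl⟩
  have hhF : h ∈ F := by
    rw [hh]; exact mul_mem (mul_mem (mul_mem hg hd) (inv_mem hg)) hd'
  have hN : ∀ l m, (g * diagGL k c * g⁻¹).val l m =
      (1 : Matrix (Fin n) (Fin n) R) l m + g l k * (c - 1 : R) * (g⁻¹).val k m := fun l m => by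
    rw [Units.val_mul, Units.val_mul, coe_diagGL, mul_add, mul_one, add_mul, Units.mul_inv,
      Matrix.add_apply, Matrix.mul_apply (M := g.val * _), Finset.sum_eq_single k
        (fun x _ hx => by rw [mul_single_apply_of_ne _ _ _ _ _ hx, zero_mul]) (by simp),
      mul_single_apply_same]
  have hm : ∀ l m, m ≠ k → h l m = (1 : Matrix (Fin n) (Fin n) R) l m := fun l m hm => by
    rw [hh, Units.val_mul, coe_diagGL, mul_add, mul_one, Matrix.add_apply,
      mul_single_apply_of_ne _ _ _ _ _ hm, hN, hrow' m hm, mul_zero, add_zero, add_zero]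
  have hk : ∀ l, h l k = (g * diagGL k c * g⁻¹).val l k * ↑c⁻¹ := fun l => by
    rw [hh, Units.val_mul, coe_diagGL, mul_add, mul_one, Matrix.add_apply,
      mul_single_apply_same, mul_sub, mul_one, add_sub_cancel]
  have h1 := elemGL_mem_of_column hD hU hc1 hhF hm (by
    rw [hk, hN, one_apply_eq, mul_sub, ← hc, mul_one, sub_mul, mul_assoc, hgk, mul_one,
      add_sub_cancel, Units.mul_inv]) hik
  rw [hk, hN, one_apply_ne hik, zero_add] at h1
  obtain ⟨s, hs⟩ := hc1
  have h2 := elemGL_mul_right_mem hD hU hik (↑c * g k k * ↑s⁻¹) h1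
  rw [← hs] at h2
  have h3 : g i k * ↑s * (g⁻¹).val k k * ↑c⁻¹ * (↑c * g k k * ↑s⁻¹) = g i k := by
    calc _ = g i k * ↑s * ((g⁻¹).val k k * (↑c⁻¹ * ↑c) * g k k) * ↑s⁻¹ := by
          simp only [mul_assoc]
      _ = g i k := by
          rw [Units.inv_mul, mul_one, hgk', mul_one, Units.mul_inv_cancel_right]
  rwa [h3] at h2

theorem conj_diagGL_apply (a : GeneralLinearGroup (Fin n) R) (r : Fin n) (u : Rˣ) (l m : Fin n) :
    (a * diagGL r u * a⁻¹).val l m =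
      (1 : Matrix (Fin n) (Fin n) R) l m + a l r * (u - 1 : R) * (a⁻¹).val r m := by
  rw [Units.val_mul, Units.val_mul, coe_diagGL, mul_add, mul_one, add_mul, Units.mul_inv,
    Matrix.add_apply, Matrix.mul_apply (M := a.val * _), Finset.sum_eq_single r
      (fun x _ hx => by rw [mul_single_apply_of_ne _ _ _ _ _ hx, zero_mul]) (by simp),
    mul_single_apply_same]

/-- This and `column_identity` compute entries (k, m) and (i, k) of p d_k(1 + γ) q for p, q as in
`elemGL_mem_of_relation`. The bracket on the right is the expression required to vanish there. -/
theorem row_identity {γ θ φ x z w : R} (hγ : ∀ x, γ * x = x * γ) :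
    x * (θ + φ + θ * φ) * w + (1 + x * θ * z) * γ * (x * φ * w) =
      x * (θ + (1 + γ) * φ + θ * (1 + γ * (z * x)) * φ) * w := by
  have e1 : x * θ * z * γ * (x * φ * w) = x * θ * γ * z * x * φ * w := by
    rw [mul_assoc (x * θ), ← hγ]
    simp only [mul_assoc]
  rw [add_mul 1, add_mul, one_mul, e1, ← mul_assoc, ← mul_assoc, hγ x]
  noncomm_ring

theorem column_identity {γ θ φ x y z : R} (hγ : ∀ x, γ * x = x * γ)
    (hrel : θ + (1 + γ) * φ + θ * (1 + γ * (z * y)) * φ = 0) :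
    x * (θ + φ + θ * φ) * z + x * θ * z * γ * (1 + y * φ * z) = γ * (x * (θ - φ) * z) := by
  have e1 : x * θ * z * γ = x * (θ * γ) * z := by
    rw [mul_assoc (x * θ), ← hγ]
    simp only [mul_assoc]
  have e2 : θ * φ + θ * γ * z * y * φ = -θ - (1 + γ) * φ := by
    rw [eq_sub_iff_add_eq, eq_neg_iff_add_eq_zero, ← hrel]; noncomm_ring
  have e3 : x * (θ + φ + θ * φ) * z + x * (θ * γ) * z * (1 + y * φ * z) =
      x * (θ + φ + (θ * φ + θ * γ * z * y * φ) + θ * γ) * z := by noncomm_ring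
  rw [e1, e3, e2, ← hγ θ, ← mul_assoc, ← mul_assoc, hγ x]
  noncomm_ring

/-- The relation is exactly what kills the off-diagonal part of row k in g = p d_k(c) q. The (i, k)
entry then collapses to (c - 1) a_ir (θ - φ) (a⁻¹)_rk. -/
theorem elemGL_mem_of_relation {F : Subgroup (GeneralLinearGroup (Fin n) R)}
    (hF : HasFitting R)
    (hD : diagonalSubgroup n R ≤ F) (hU : ∀ a : R, a ∈ AddSubgroup.closure {u : R | IsUnit u})
    {c : Rˣ} (hc : ∀ x : R, c * x = x * c) (hc1 : IsUnit (c - 1 : R))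
    {a : GeneralLinearGroup (Fin n) R} (ha : a ∈ F) (r : Fin n) {i k : Fin n} (hik : i ≠ k)
    {θ φ : R} (hθ : IsUnit (1 + θ)) (hφ : IsUnit (1 + φ))
    (hrel : θ + c * φ + θ * (1 + (c - 1) * ((a⁻¹).val r k * a k r)) * φ = 0) :
    elemGL hik (a i r * (θ - φ) * (a⁻¹).val r k) ∈ F := by
  obtain ⟨u, hu⟩ := hθ
  obtain ⟨v, hv⟩ := hφ
  have hu' : (u : R) - 1 = θ := by rw [hu, add_sub_cancel_left]
  have hv' : (v : R) - 1 = φ := by rw [hv, add_sub_cancel_left]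
  obtain ⟨γ, hγ⟩ : ∃ γ : R, γ = c - 1 := ⟨_, rfl⟩
  have hγc : ∀ x, γ * x = x * γ := fun x => by rw [hγ, sub_mul, mul_sub, hc, one_mul, mul_one]
  have hcγ : (c : R) = 1 + γ := by rw [hγ]; abel
  obtain ⟨p, hp⟩ : ∃ p, p = a * diagGL r u * a⁻¹ := ⟨_, rfl⟩
  obtain ⟨q, hq⟩ : ∃ q, q = a * diagGL r v * a⁻¹ := ⟨_, rfl⟩
  have hpF : p ∈ F := hp ▸ mul_mem (mul_mem ha (hD (diagGL_mem_diagonalSubgroup r u))) (inv_mem ha)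
  have hqF : q ∈ F := hq ▸ mul_mem (mul_mem ha (hD (diagGL_mem_diagonalSubgroup r v))) (inv_mem ha)
  have hpe : ∀ l m, p l m = (1 : Matrix (Fin n) (Fin n) R) l m + a l r * θ * (a⁻¹).val r m :=
    fun l m => by rw [hp, conj_diagGL_apply, hu']
  have hqe : ∀ l m, q l m = (1 : Matrix (Fin n) (Fin n) R) l m + a l r * φ * (a⁻¹).val r m :=
    fun l m => by rw [hq, conj_diagGL_apply, hv']
  have hpq : ∀ l m, (p * q) l m = (1 : Matrix (Fin n) (Fin n) R) l m +
      a l r * (θ + φ + θ * φ) * (a⁻¹).val r m := fun l m => by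
    have : p * q = a * diagGL r (u * v) * a⁻¹ := by
      have : diagGL r (u * v) = diagGL r u * diagGL r v := Units.ext (by
        simp only [Units.val_mul, coe_diagGL, add_mul, mul_add, one_mul, mul_one,
          single_mul_single_same, sub_mul, mul_sub, single_sub']
        abel)
      rw [hp, hq, this]; group
    rw [this, conj_diagGL_apply, Units.val_mul, hu, hv]
    noncomm_ring
  obtain ⟨g, hg⟩ : ∃ g, g = p * diagGL k c * q := ⟨_, rfl⟩
  have hgF : g ∈ F := hg ▸ mul_mem (mul_mem hpF (hD (diagGL_mem_diagonalSubgroup k c))) hqF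
  have hge : ∀ l m, g l m = (p * q) l m + p l k * γ * q k m := fun l m => by
    rw [hg, Units.val_mul, Units.val_mul, coe_diagGL, mul_add, mul_one, add_mul, Matrix.add_apply,
      Matrix.mul_apply (M := p.val * _), Finset.sum_eq_single k
        (fun x _ hx => by rw [mul_single_apply_of_ne _ _ _ _ _ hx, zero_mul]) (by simp),
      mul_single_apply_same, ← hγ, Units.val_mul]
  rw [← hγ, hcγ] at hrel
  have h1 := elemGL_mem_of_row_eq_zero hF hD hU hc hc1 hgF (k := k) (fun m hm => by
    rw [hge, hpq, hpe, hqe, one_apply_ne hm.symm, one_apply_eq, zero_add, zero_add]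
    rw [row_identity hγc, hrel, mul_zero, zero_mul]) hik
  have h2 : g i k = γ * (a i r * (θ - φ) * (a⁻¹).val r k) := by
    rw [hge, hpq, hpe, hqe, one_apply_ne hik, one_apply_eq, zero_add, zero_add,
      column_identity hγc hrel]
  rw [h2, hγ] at h1
  exact elemGL_mem_of_isUnit_mul hD hU hik hc1 h1

end extraction

/-! ### The case w = 1: a quadratic family of solutions. -/

theorem Submodule.mem_of_vandermonde {K M : Type*} [CommRing K] [AddCommGroup M] [Module K M]
    (N : Submodule K M) {t₀ t₁ t₂ : K} (h₀₁ : IsUnit (t₀ - t₁)) (h₀₂ : IsUnit (t₀ - t₂))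
    (h₁₂ : IsUnit (t₁ - t₂)) {p q r : M} (h₀ : p + t₀ • q + t₀ ^ 2 • r ∈ N)
    (h₁ : p + t₁ • q + t₁ ^ 2 • r ∈ N) (h₂ : p + t₂ • q + t₂ ^ 2 • r ∈ N) :
    p ∈ N ∧ q ∈ N ∧ r ∈ N := by
  have e₁ : q + (t₀ + t₁) • r ∈ N := by
    rw [← N.smul_mem_iff_of_isUnit h₀₁]
    convert N.sub_mem h₀ h₁ using 1
    module
  have e₂ : q + (t₀ + t₂) • r ∈ N := by
    rw [← N.smul_mem_iff_of_isUnit h₀₂]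
    convert N.sub_mem h₀ h₂ using 1
    module
  have hr : r ∈ N := by
    rw [← N.smul_mem_iff_of_isUnit h₁₂]
    convert N.sub_mem e₁ e₂ using 1
    module
  have hq : q ∈ N := by
    convert N.sub_mem e₁ (N.smul_mem (t₀ + t₁) hr) using 1
    module
  refine ⟨?_, hq, hr⟩
  convert N.sub_mem (N.sub_mem h₀ (N.smul_mem t₀ hq)) (N.smul_mem (t₀ ^ 2) hr) using 1
  module

/-- The elements `w` with `x * w * y ∈ I`. -/
def TwoSidedIdeal.sandwich {R : Type*} [Ring R] (I : TwoSidedIdeal R) (x y : R) :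
    Submodule (Subring.center R) R where
  carrier := {w | x * w * y ∈ I}
  add_mem' := fun {a b} ha hb => by
    change x * (a + b) * y ∈ I
    rw [mul_add, add_mul]; exact I.add_mem ha hb
  zero_mem' := by
    change x * 0 * y ∈ I
    rw [mul_zero, zero_mul]; exact zero_mem _
  smul_mem' := fun c w hw => by
    change x * (c * w) * y ∈ I
    have : x * (c * w) * y = c * (x * w * y) := by
      rw [← mul_assoc, Subring.mem_center_iff.1 c.2 x]; simp only [mul_assoc]
    rw [this]; exact TwoSidedIdeal.mul_mem_left _ _ _ hw

theorem TwoSidedIdeal.mem_sandwich {R : Type*} [Ring R] {I : TwoSidedIdeal R} {x y w : R} :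
    w ∈ I.sandwich x y ↔ x * w * y ∈ I := Iff.rfl

/-- The central units, as units of the ring. -/
noncomputable def CentralUnits.unit {R : Type*} [Ring R] (T : CentralUnits R) (i : Fin 6) : Rˣ :=
  Units.map ((Subring.center R).subtype : Subring.center R →* R) (T.isUnit i).unit

theorem CentralUnits.coe_unit {R : Type*} [Ring R] (T : CentralUnits R) (i : Fin 6) :
    (T.unit i : R) = T.val i := rfl

theorem CentralUnits.unit_mul_comm {R : Type*} [Ring R] (T : CentralUnits R) (i : Fin 6) (x : R) :
    (T.unit i : R) * x = x * T.unit i := (Subring.mem_center_iff.1 (T.val i).2 x).symm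

theorem CentralUnits.isUnit_sub_one {R : Type*} [Ring R] (T : CentralUnits R) {i : Fin 6}
    (hi : i ≠ 0) : IsUnit (T.val i - 1) := by
  rw [← T.zero]; exact T.isUnit_sub i 0 hi

/-- On f, where μ inverts ν, the choice φ = t - μ turns 1 + ν φ into t ν, so the relation can be
solved for θ; off f both are 0. The two divisibilities make 1 + φ and 1 + θ units. In the final
quadratic in t the coefficient of t² is f. -/
theorem exists_relation_of_dvd {A : Type*} [CommRing A] {f ν μ c t s : A} (hf : IsIdempotentElem f)
    (hμ : ν * μ = f) (hfμ : f * μ = μ) (hts : t * s = 1) (h1 : (1 + t) * ν - 1 ∣ f)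
    (h2 : t * ν * (ν - c) + c ∣ f) :
    ∃ θ φ : A, IsUnit (1 + θ) ∧ IsUnit (1 + φ) ∧ θ + c * φ + θ * ν * φ = 0 ∧
      -t * (θ - φ) = -(c * μ ^ 2) + t * ((c - 1) * μ) + t ^ 2 * f := by
  have hff : f * f = f := hf
  refine ⟨-(c * μ) + c * s * μ ^ 2, t * f - μ, ?_, ?_, ?_, ?_⟩
  · obtain ⟨z, hz⟩ := h2
    have := isUnit_mul_add_one_sub hf (x := s * μ ^ 2 * (t * ν * (ν - c) + c))
      ⟨t * ν ^ 2 * z, by grind⟩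
    convert this using 1
    grind
  · obtain ⟨z, hz⟩ := h1
    have := isUnit_mul_add_one_sub hf (x := μ * ((1 + t) * ν - 1)) ⟨ν * z, by grind⟩
    convert this using 1
    grind
  · grind
  · grind

section extraction
open Matrix

variable {n : ℕ} {R : Type*} [Ring R] {F : Subgroup (GeneralLinearGroup (Fin n) R)}

/-- Three admissible central parameters isolate the t² coefficient of -t (θ - φ), which is f. -/
theorem coe_mem_sandwich_of_dvd (hF : HasFitting R) (T : CentralUnits R)
    (hD : diagonalSubgroup n R ≤ F) {a : GeneralLinearGroup (Fin n) R} (ha : a ∈ F) (r : Fin n)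
    {i k : Fin n} (hik : i ≠ k) {ω : R} (hω : ω = (a⁻¹).val r k * a k r) {ω' ν : bicommutant ω}
    (hω' : (ω' : R) = ω) {l : Fin 6} (hl : l ≠ 0) (hν : ν = 1 + (T.toBicommutant ω l - 1) * ω')
    {f : bicommutant ω} (hf : IsIdempotentElem f) (hνf : ν ∣ f)
    {j₀ j₁ j₂ : Fin 6} (h₀₁ : j₀ ≠ j₁) (h₀₂ : j₀ ≠ j₂) (h₁₂ : j₁ ≠ j₂)
    (h : ∀ j, j = j₀ ∨ j = j₁ ∨ j = j₂ → (1 + T.toBicommutant ω j) * ν - 1 ∣ f ∧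
      T.toBicommutant ω j * ν * (ν - T.toBicommutant ω l) + T.toBicommutant ω l ∣ f) :
    (f : R) ∈ ((DNet.ofSubgroup F hD (T.mem_closure_isUnit hF)).ideal i k).sandwich
      (a i r) ((a⁻¹).val r k) := by
  have hff : f * f = f := hf
  obtain ⟨μ', hμ'⟩ := hνf
  obtain ⟨μ, hμ⟩ : ∃ μ, μ = f * μ' := ⟨_, rfl⟩
  have hνμ : ν * μ = f := by grind
  have hfμ : f * μ = μ := by grind
  have key : ∀ j, j = j₀ ∨ j = j₁ ∨ j = j₂ →
      (-(T.toBicommutant ω l * μ ^ 2) : bicommutant ω) +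
        T.val j • (((T.toBicommutant ω l - 1) * μ : bicommutant ω) : R) +
        (T.val j) ^ 2 • (f : R) ∈
      ((DNet.ofSubgroup F hD (T.mem_closure_isUnit hF)).ideal i k).sandwich
        (a i r) ((a⁻¹).val r k) := by
    intro j hj
    obtain ⟨s, hs⟩ := (T.isUnit j).exists_right_inv
    obtain ⟨θ, φ, hθ, hφ, hrel, heq⟩ := exists_relation_of_dvd hf hνμ hfμ
      (t := T.toBicommutant ω j) (s := Subring.inclusion (center_le_bicommutant ω) s)
      (c := T.toBicommutant ω l)
      (by rw [CentralUnits.toBicommutant, ← map_mul, hs, map_one]) (h j hj).1 (h j hj).2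
    have h1 := elemGL_mem_of_relation hF hD (T.mem_closure_isUnit hF) (c := T.unit l)
      (T.unit_mul_comm l) ((T.isUnit_sub_one hl).map (Subring.center R).subtype) ha r hik
      (θ := θ) (φ := φ) (hθ.map (bicommutant ω).subtype) (hφ.map (bicommutant ω).subtype) (by
        have := congrArg Subtype.val hrel
        rw [hν] at this
        rw [hω.symm.trans hω'.symm]
        exact this)
    have h2 : (θ - φ : R) ∈ ((DNet.ofSubgroup F hD (T.mem_closure_isUnit hF)).ideal i k).sandwich
        (a i r) ((a⁻¹).val r k) := by
      rw [TwoSidedIdeal.mem_sandwich, DNet.mem_ofSubgroup]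
      exact fun _ => h1
    have h3 := Submodule.smul_mem _ (-T.val j) h2
    have h4 := congrArg Subtype.val heq
    rw [Subring.smul_def, smul_eq_mul] at h3
    have h5 : (-T.val j : Subring.center R) * (θ - φ : R) = _ := h4
    rw [h5] at h3
    exact h3
  exact (Submodule.mem_of_vandermonde _ (T.isUnit_sub _ _ h₀₁) (T.isUnit_sub _ _ h₀₂)
    (T.isUnit_sub _ _ h₁₂) (key _ (.inl rfl)) (key _ (.inr (.inl rfl)))
    (key _ (.inr (.inr rfl)))).2.2

/-- Each condition is affine in t and nonzero modulo m, so it fails for at most one of the six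
values; at least four survive. -/
theorem exists_three_of_bad {A : Type*} [CommRing A] {m : Ideal A} (hm : m.IsPrime) (t : Fin 6 → A)
    (hts : ∀ i j, i ≠ j → IsUnit (t i - t j)) {ν c : A} (hν : ν ∉ m) (hc : c ∉ m) :
    ∃ j₀ j₁ j₂ : Fin 6, j₀ ≠ j₁ ∧ j₀ ≠ j₂ ∧ j₁ ≠ j₂ ∧ ∀ j, j = j₀ ∨ j = j₁ ∨ j = j₂ →
      (1 + t j) * ν - 1 ∉ m ∧ t j * ν * (ν - c) + c ∉ m := by
  classical
  have hunit : ∀ i j x, i ≠ j → (t i - t j) * x ∈ m → x ∈ m := fun i j x hij hx =>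
    (hm.mem_or_mem hx).resolve_left fun h => hm.ne_top (m.eq_top_of_isUnit_mem h (hts i j hij))
  have hb1 : (Finset.univ.filter fun j => (1 + t j) * ν - 1 ∈ m).card ≤ 1 := by
    refine Finset.card_le_one.2 fun i hi j hj => ?_
    by_contra hij
    rw [Finset.mem_filter] at hi hj
    refine hν (hunit i j ν hij ?_)
    convert m.sub_mem hi.2 hj.2 using 1
    ring
  have hb2 : (Finset.univ.filter fun j => t j * ν * (ν - c) + c ∈ m).card ≤ 1 := by
    refine Finset.card_le_one.2 fun i hi j hj => ?_
    by_contra hij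
    rw [Finset.mem_filter] at hi hj
    have h1 : ν * (ν - c) ∈ m := hunit i j _ hij (by
      convert m.sub_mem hi.2 hj.2 using 1
      ring)
    apply hc
    convert m.sub_mem hi.2 (m.mul_mem_left (t i) h1) using 1
    ring
  have hcard := Finset.card_sdiff_add_card_inter (Finset.univ : Finset (Fin 6))
    ((Finset.univ.filter fun j => (1 + t j) * ν - 1 ∈ m) ∪
      (Finset.univ.filter fun j => t j * ν * (ν - c) + c ∈ m))
  have hle := Finset.card_union_le (Finset.univ.filter fun j => (1 + t j) * ν - 1 ∈ m)
      (Finset.univ.filter fun j => t j * ν * (ν - c) + c ∈ m)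
  rw [Finset.univ_inter, Finset.card_univ, Fintype.card_fin] at hcard
  have hlt : 2 < (Finset.univ \ ((Finset.univ.filter fun j => (1 + t j) * ν - 1 ∈ m) ∪
      (Finset.univ.filter fun j => t j * ν * (ν - c) + c ∈ m))).card := by omega
  obtain ⟨j₀, hj₀, j₁, hj₁, j₂, hj₂, h₀₁, h₀₂, h₁₂⟩ := Finset.two_lt_card.1 hlt
  simp only [Finset.mem_sdiff, Finset.mem_univ, true_and, Finset.mem_union, Finset.mem_filter,
    not_or] at hj₀ hj₁ hj₂
  refine ⟨j₀, j₁, j₂, h₀₁, h₀₂, h₁₂, ?_⟩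
  rintro j (rfl | rfl | rfl)
  exacts [hj₀, hj₁, hj₂]

/-- Gluing over the bicommutant of ω: near each maximal ideal, c and three parameters can be chosen
for which all the required elements are invertible. -/
theorem one_mem_sandwich (hF : HasFitting R) (T : CentralUnits R)
    (hD : diagonalSubgroup n R ≤ F) {a : GeneralLinearGroup (Fin n) R} (ha : a ∈ F) (r : Fin n)
    {i k : Fin n} (hik : i ≠ k) :
    1 ∈ ((DNet.ofSubgroup F hD (T.mem_closure_isUnit hF)).ideal i k).sandwich
      (a i r) ((a⁻¹).val r k) := by
  obtain ⟨ω, hω⟩ : ∃ ω, ω = (a⁻¹).val r k * a k r := ⟨_, rfl⟩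
  obtain ⟨ω', hω'⟩ : ∃ ω' : bicommutant ω, (ω' : R) = ω := ⟨⟨ω, self_mem_bicommutant ω⟩, rfl⟩
  have htu : ∀ i, IsUnit (T.toBicommutant ω i) := fun i => (T.isUnit i).map (Subring.inclusion _)
  have hts : ∀ i j, i ≠ j → IsUnit (T.toBicommutant ω i - T.toBicommutant ω j) := fun i j hij => by
    have := (T.isUnit_sub i j hij).map (Subring.inclusion (center_le_bicommutant ω))
    rwa [map_sub] at this
  refine idempotent_cover (hF.bicommutant ω) (Q := fun f => (f : R) ∈
    ((DNet.ofSubgroup F hD (T.mem_closure_isUnit hF)).ideal i k).sandwich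
      (a i r) ((a⁻¹).val r k)) (Submodule.zero_mem _) ?_ ?_
  · intro f g _ _ _ h1 h2
    exact Submodule.add_mem _ h1 h2
  · intro m hm
    -- If both l = 1 and l = 2 failed, eliminating ω' would put the unit t 2 - t 1 in m.
    obtain ⟨l, hl, hνm⟩ : ∃ l : Fin 6, l ≠ 0 ∧ 1 + (T.toBicommutant ω l - 1) * ω' ∉ m := by
      by_contra! hcon
      have h1 := hcon 1 (by decide)
      have h2 := hcon 2 (by decide)
      refine hm.ne_top (m.eq_top_of_isUnit_mem ?_ (hts 2 1 (by decide)))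
      convert m.sub_mem (m.mul_mem_left (T.toBicommutant ω 2 - 1) h1)
        (m.mul_mem_left (T.toBicommutant ω 1 - 1) h2) using 1
      ring
    obtain ⟨ν, hν⟩ : ∃ ν, ν = 1 + (T.toBicommutant ω l - 1) * ω' := ⟨_, rfl⟩
    rw [← hν] at hνm
    obtain ⟨j₀, j₁, j₂, h₀₁, h₀₂, h₁₂, hj⟩ := exists_three_of_bad hm.isPrime (T.toBicommutant ω) hts
      hνm (c := T.toBicommutant ω l) fun h => hm.ne_top (m.eq_top_of_isUnit_mem h (htu l))
    obtain ⟨P, hP⟩ : ∃ P : Fin 6 → bicommutant ω, P = fun j =>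
      ((1 + T.toBicommutant ω j) * ν - 1) *
        (T.toBicommutant ω j * ν * (ν - T.toBicommutant ω l) + T.toBicommutant ω l) := ⟨_, rfl⟩
    have hPm : ∀ j, j = j₀ ∨ j = j₁ ∨ j = j₂ → P j ∉ m := fun j h hmem => by
      rw [hP] at hmem
      exact (hm.isPrime.mem_or_mem hmem).elim (hj j h).1 (hj j h).2
    refine ⟨ν * (P j₀ * P j₁ * P j₂), fun hmem => ?_, fun f hf hdvd => ?_⟩
    · rcases hm.isPrime.mem_or_mem hmem with h | h
      · exact hνm h
      rcases hm.isPrime.mem_or_mem h with h | h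
      · exact (hm.isPrime.mem_or_mem h).elim (hPm _ (.inl rfl)) (hPm _ (.inr (.inl rfl)))
      · exact hPm _ (.inr (.inr rfl)) h
    · refine coe_mem_sandwich_of_dvd hF T hD ha r hik hω hω' hl hν hf
        ((Dvd.intro _ rfl).trans hdvd) h₀₁ h₀₂ h₁₂ fun j h => ?_
      have hPj : P j ∣ f := by
        refine Dvd.dvd.trans ?_ hdvd
        rcases h with rfl | rfl | rfl
        · exact ⟨ν * (P j₁ * P j₂), by ring⟩
        · exact ⟨ν * (P j₀ * P j₂), by ring⟩
        · exact ⟨ν * (P j₀ * P j₁), by ring⟩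
      rw [hP] at hPj
      exact ⟨(Dvd.intro _ rfl).trans hPj, (Dvd.intro_left _ rfl).trans hPj⟩

end extraction

/-! ### From w = 1 to arbitrary w. -/

/-- Λ is only a module over the center. It is shown to contain (1 - ω) R, R ω, the conjugates of ω
and all idempotents; the Peirce decomposition at the Fitting idempotent of ω then exhausts R. -/
theorem CentralUnits.mem_of_forall_isUnit {R : Type*} [Ring R] (T : CentralUnits R)
    (hF : HasFitting R) (Λ : Submodule (Subring.center R) R) {ω : R}
    (h : ∀ u : Rˣ, (1 + (u - 1) * ω) * (↑u⁻¹ - 1 : R) ∈ Λ) (w : R) : w ∈ Λ := by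
  have hU := T.mem_closure_isUnit hF
  have key : ∀ u : Rˣ, (1 - ω) * ↑u⁻¹ ∈ Λ ∧ u * ω * ↑u⁻¹ - 1 + ω ∈ Λ ∧ -(u * ω) ∈ Λ := by
    intro u
    -- Replacing u by t u with t central, and multiplying by t, makes the hypothesis quadratic in t.
    have h1 : ∀ i, (1 - ω) * ↑u⁻¹ + T.val i • (u * ω * ↑u⁻¹ - 1 + ω) +
        (T.val i) ^ 2 • (-(u * ω)) ∈ Λ := fun i => by
      have h1 := Λ.smul_mem (T.val i) (h (T.unit i * u))
      rw [Subring.smul_def, smul_eq_mul] at h1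
      rw [Subring.smul_def, Subring.smul_def, smul_eq_mul, smul_eq_mul, Subring.coe_pow]
      rw [← T.coe_unit] at h1 ⊢
      obtain ⟨c, hc⟩ : ∃ c, c = T.unit i := ⟨_, rfl⟩
      have hcc : ∀ x : R, c * x = x * c := fun x => hc ▸ T.unit_mul_comm i x
      rw [← hc] at h1 ⊢
      have hcv : ∀ x : R, x * ↑c⁻¹ = ↑c⁻¹ * x := fun x => by
        rw [Units.eq_inv_mul_iff_mul_eq, ← mul_assoc, hcc, Units.mul_inv_cancel_right]
      convert h1 using 1
      have e1 : (c : R) * ((1 + (↑(c * u) - 1) * ω) * (↑(c * u)⁻¹ - 1)) =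
          (1 + (c * u - 1) * ω) * ↑u⁻¹ - c * (1 + (c * u - 1) * ω) := by
        rw [mul_inv_rev, Units.val_mul, Units.val_mul, hcv, mul_sub, mul_sub, mul_one, ← mul_assoc,
          ← mul_assoc, hcc, mul_assoc _ (c : R), Units.mul_inv, mul_one]
      rw [e1]
      noncomm_ring
    exact Λ.mem_of_vandermonde (T.isUnit_sub 0 1 (by decide)) (T.isUnit_sub 0 2 (by decide))
      (T.isUnit_sub 1 2 (by decide)) (h1 0) (h1 1) (h1 2)
  have hl : ∀ w, (1 - ω) * w ∈ Λ := fun w => by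
    induction hU w using AddSubgroup.closure_induction with
    | mem u hu => obtain ⟨u, rfl⟩ := hu; simpa using (key u⁻¹).1
    | zero => rw [mul_zero]; exact Λ.zero_mem
    | add a b _ _ ha hb => rw [mul_add]; exact Λ.add_mem ha hb
    | neg a _ ha => rw [mul_neg]; exact Λ.neg_mem ha
  have hr : ∀ w, w * ω ∈ Λ := fun w => by
    induction hU w using AddSubgroup.closure_induction with
    | mem u hu => obtain ⟨u, rfl⟩ := hu; simpa using Λ.neg_mem (key u).2.2
    | zero => rw [zero_mul]; exact Λ.zero_mem
    | add a b _ _ ha hb => rw [add_mul]; exact Λ.add_mem ha hb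
    | neg a _ ha => rw [neg_mul]; exact Λ.neg_mem ha
  have hconj : ∀ u : Rˣ, u * ω * ↑u⁻¹ ∈ Λ := fun u => by
    have h1 := Λ.add_mem (key u).2.1 (hl 1)
    convert h1 using 1
    noncomm_ring
  have hidem : ∀ e : R, e * e = e → e ∈ Λ := by
    intro e he
    -- Conjugation of ω by the unit 1 + (c - 1) e, modulo R ω; two values of c separate ω e from e ω
    -- e.
    have h1 : ∀ i : Fin 6, i ≠ 0 → ω * e + (T.val i - 1) • (e * ω * e) ∈ Λ := fun i hi => by
      obtain ⟨c, hc⟩ : ∃ c, c = T.unit i := ⟨_, rfl⟩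
      have hcc : ∀ x : R, c * x = x * c := fun x => hc ▸ T.unit_mul_comm i x
      obtain ⟨γ, hγ⟩ : ∃ γ : R, γ = c - 1 := ⟨_, rfl⟩
      have hγc : ∀ x : R, x * γ = γ * x := fun x => by rw [hγ, sub_mul, mul_sub, hcc, one_mul, mul_one]
      have hcve : e * (↑c⁻¹ - 1) = (↑c⁻¹ - 1) * e := by
        rw [mul_sub, sub_mul, mul_one, one_mul]
        congr 1
        rw [Units.eq_inv_mul_iff_mul_eq, ← mul_assoc, hcc, Units.mul_inv_cancel_right]
      have hv : γ + (↑c⁻¹ - 1) + γ * (↑c⁻¹ - 1) = 0 := by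
        rw [hγ, sub_mul, mul_sub, Units.mul_inv]; noncomm_ring
      have hv' : γ + (↑c⁻¹ - 1) + (↑c⁻¹ - 1) * γ = 0 := by rw [hγc, hv]
      let u : Rˣ := ⟨1 + γ * e, 1 + (↑c⁻¹ - 1) * e, by
        have : (1 + γ * e) * (1 + (↑c⁻¹ - 1) * e) =
            1 + (γ + (↑c⁻¹ - 1)) * e + γ * (e * (↑c⁻¹ - 1)) * e := by noncomm_ring
        rw [this, hcve]
        calc _ = 1 + (γ + (↑c⁻¹ - 1)) * e + γ * (↑c⁻¹ - 1) * (e * e) := by noncomm_ring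
          _ = 1 + (γ + (↑c⁻¹ - 1) + γ * (↑c⁻¹ - 1)) * e := by rw [he]; noncomm_ring
          _ = 1 := by rw [hv]; simp, by
        have : (1 + (↑c⁻¹ - 1) * e) * (1 + γ * e) =
            1 + (γ + (↑c⁻¹ - 1)) * e + (↑c⁻¹ - 1) * (e * γ) * e := by noncomm_ring
        rw [this, hγc]
        calc _ = 1 + (γ + (↑c⁻¹ - 1)) * e + (↑c⁻¹ - 1) * γ * (e * e) := by noncomm_ring
          _ = 1 + (γ + (↑c⁻¹ - 1) + (↑c⁻¹ - 1) * γ) * e := by rw [he]; noncomm_ring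
          _ = 1 := by rw [hv']; simp⟩
      have hu : (c : R) * ↑u⁻¹ = c - γ * e := by
        change (c : R) * (1 + (↑c⁻¹ - 1) * e) = _
        rw [mul_add, ← mul_assoc, mul_sub, Units.mul_inv, hγ]; noncomm_ring
      have h2 : (c : R) * (u * ω * ↑u⁻¹) = (1 + γ * e) * ω * (c - γ * e) := by
        rw [← mul_assoc, hcc, mul_assoc, hu]
      rw [← Λ.smul_mem_iff_of_isUnit (T.isUnit_sub_one hi)]
      convert Λ.sub_mem (Λ.add_mem (Λ.smul_mem (T.val i) (hr 1))
        (Λ.smul_mem (T.val i) (hr (γ * e)))) (Λ.smul_mem (T.val i) (hconj u)) using 1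
      simp only [Subring.smul_def, smul_eq_mul]
      have hγ' : ((T.val i - 1 : Subring.center R) : R) = γ := by rw [hγ, hc]; rfl
      rw [hγ', ← T.coe_unit, ← hc, h2]
      have e1 : (1 + γ * e) * ω * (c - γ * e) =
          ω * c + γ * e * ω * c - ω * γ * e - γ * (e * ω * γ) * e := by noncomm_ring
      rw [e1, hγc, hγc, ← hcc, ← hcc]
      noncomm_ring
    have h2 : e * ω * e ∈ Λ := by
      rw [← Λ.smul_mem_iff_of_isUnit (T.isUnit_sub 1 2 (by decide))]
      convert Λ.sub_mem (h1 1 (by decide)) (h1 2 (by decide)) using 1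
      module
    have h3 : ω * e ∈ Λ := by
      convert Λ.sub_mem (h1 1 (by decide)) (Λ.smul_mem (T.val 1 - 1) h2) using 1
      module
    convert Λ.add_mem (hl e) h3 using 1
    noncomm_ring
  obtain ⟨b, hb, he, hnil⟩ := hF ω
  have hωb : b * ω = ω * b := hb ω (Commute.refl ω)
  obtain ⟨e, heq⟩ : ∃ e, e = ω * b := ⟨_, rfl⟩
  rw [← heq] at he hnil
  have hee : e * e = e := he
  have hωe : ω * e = e * ω := by rw [heq, mul_assoc, hωb]
  obtain ⟨s, hs⟩ := hnil.isUnit_one_sub.exists_right_inv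
  have h1 : w * e ∈ Λ := by rw [heq, ← hωb, ← mul_assoc]; exact hr _
  -- ω is nilpotent on 1 - e, so 1 - ω is invertible there.
  have h2 : ∀ w, (1 - e) * w ∈ Λ := fun w => by
    have : 1 - e = (1 - ω) * ((1 - e) * s) := by
      have : (1 - ω) * (1 - e) = (1 - e) * (1 - ω * (1 - e)) := by
        have : (1 - e) * (ω * (1 - e)) = ω * (1 - e) := by
          calc (1 - e) * (ω * (1 - e)) = ω * (1 - e) - e * ω + e * ω * e := by noncomm_ring
            _ = ω * (1 - e) := by rw [← hωe, mul_assoc ω, hee]; noncomm_ring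
        rw [mul_sub (1 - e) 1, this]; noncomm_ring
      rw [← mul_assoc, this, mul_assoc, hs, mul_one]
    rw [this, mul_assoc]; exact hl _
  have h3 : e * w * (1 - e) ∈ Λ := by
    have h4 : e * (1 - e) = 0 := by rw [mul_sub, hee, mul_one, sub_self]
    have h5 : (1 - e) * e = 0 := by rw [sub_mul, hee, one_mul, sub_self]
    -- The remaining corner is a difference of two idempotents.
    have h6 := hidem (e + e * w * (1 - e)) (by
      rw [add_mul, mul_add, mul_add, hee, mul_assoc _ (1 - e) e, h5, mul_assoc _ (1 - e),
        ← mul_assoc (1 - e), ← mul_assoc (1 - e), h5, ← mul_assoc e, ← mul_assoc e, hee]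
      simp)
    simpa using Λ.sub_mem h6 (hidem e hee)
  have : w = w * e + e * w * (1 - e) + (1 - e) * (w * (1 - e)) := by noncomm_ring
  rw [this]
  exact Λ.add_mem (Λ.add_mem h1 h3) (h2 _)

/-! ### Normalizer, uniqueness and finite index. -/

section main
open Matrix

variable {n : ℕ} {R : Type*} [Ring R] {F : Subgroup (GeneralLinearGroup (Fin n) R)}

theorem conj_diagGL_inv (a : GeneralLinearGroup (Fin n) R) (r : Fin n) (u : Rˣ) :
    (a * diagGL r u * a⁻¹)⁻¹ = a * diagGL r u⁻¹ * a⁻¹ := by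
  have : (diagGL r u)⁻¹ = diagGL r u⁻¹ := Units.ext rfl
  rw [← this]; group

/-- For b = a d_r(u) a⁻¹ ∈ F, the case w = 1 puts b_ii (b⁻¹)_ik in σ_ik. This product is a_ir (1 +
(u - 1) ω) (u⁻¹ - 1) (a⁻¹)_rk with ω = (a⁻¹)_ri a_ir. -/
theorem mul_mul_inv_mem_ofSubgroup (hF : HasFitting R) (T : CentralUnits R)
    (hD : diagonalSubgroup n R ≤ F) {a : GeneralLinearGroup (Fin n) R} (ha : a ∈ F) (r : Fin n)
    {i k : Fin n} (hik : i ≠ k) (w : R) :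
    a i r * w * (a⁻¹).val r k ∈ (DNet.ofSubgroup F hD (T.mem_closure_isUnit hF)).ideal i k := by
  refine TwoSidedIdeal.mem_sandwich.1
    (T.mem_of_forall_isUnit hF _ (ω := (a⁻¹).val r i * a i r) (fun u => ?_) w)
  have hb : a * diagGL r u * a⁻¹ ∈ F :=
    mul_mem (mul_mem ha (hD (diagGL_mem_diagonalSubgroup r u))) (inv_mem ha)
  have h1 := TwoSidedIdeal.mem_sandwich.1 (one_mem_sandwich hF T hD hb i hik)
  rw [conj_diagGL_inv, conj_diagGL_apply, conj_diagGL_apply, one_apply_eq, one_apply_ne hik,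
    zero_add, mul_one] at h1
  rw [TwoSidedIdeal.mem_sandwich]
  convert h1 using 1
  noncomm_ring

theorem conj_mem_matrices_ofSubgroup (hF : HasFitting R) (T : CentralUnits R)
    (hD : diagonalSubgroup n R ≤ F) {a : GeneralLinearGroup (Fin n) R} (ha : a ∈ F)
    {M : Matrix (Fin n) (Fin n) R}
    (hM : M ∈ (DNet.ofSubgroup F hD (T.mem_closure_isUnit hF)).matrices) :
    a.val * M * (a⁻¹).val ∈ (DNet.ofSubgroup F hD (T.mem_closure_isUnit hF)).matrices := by
  intro i j
  by_cases hij : i = j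
  · subst hij
    rw [DNet.diag]; trivial
  rw [Matrix.mul_apply]
  refine sum_mem fun s _ => ?_
  rw [Matrix.mul_apply, Finset.sum_mul]
  refine sum_mem fun r _ => ?_
  by_cases hrs : r = s
  · subst hrs
    exact mul_mul_inv_mem_ofSubgroup hF T hD ha r hij _
  -- Multiplying a by the transvection at (r, s) adds a_ir M_rs to a_is and leaves row s of the
  -- inverse unchanged; subtracting the two memberships isolates the cross term.
  · have hb := mul_mem ha (DNet.mem_ofSubgroup.1 (hM r s) hrs)
    have h1 := mul_mul_inv_mem_ofSubgroup hF T hD hb s hij 1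
    have h2 := mul_mul_inv_mem_ofSubgroup hF T hD ha s hij 1
    rw [_root_.mul_inv_rev, Units.val_mul, Units.val_mul, coe_inv_elemGL, coe_elemGL, mul_add, mul_one,
      Matrix.add_apply, mul_single_apply_same, sub_mul, one_mul, Matrix.sub_apply,
      single_mul_apply_of_ne _ _ _ _ _ (Ne.symm hrs), sub_zero, mul_one, add_mul] at h1
    rw [mul_one] at h2
    simpa using sub_mem h1 h2

theorem le_normalizer_ofSubgroup (hF : HasFitting R) (T : CentralUnits R)
    (hD : diagonalSubgroup n R ≤ F) :
    F ≤ Subgroup.normalizer (DNet.ofSubgroup F hD (T.mem_closure_isUnit hF)).netSubgroup := by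
  have key : ∀ a ∈ F, ∀ g ∈ (DNet.ofSubgroup F hD (T.mem_closure_isUnit hF)).netSubgroup,
      a * g * a⁻¹ ∈ (DNet.ofSubgroup F hD (T.mem_closure_isUnit hF)).netSubgroup := by
    intro a ha g hg
    refine ⟨conj_mem_matrices_ofSubgroup hF T hD ha hg.1, ?_⟩
    have : (a * g * a⁻¹)⁻¹ = a * g⁻¹ * a⁻¹ := by group
    rw [this]
    exact conj_mem_matrices_ofSubgroup hF T hD ha hg.2
  intro a ha
  refine Subgroup.mem_normalizer_iff.2 fun g => ⟨key a ha g, fun h => ?_⟩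
  have := key a⁻¹ (inv_mem ha) _ h
  simpa [mul_assoc] using this

/-- Conjugating `diagGL j c` by the transvection produces the (i, j) entry x (c - 1), and c - 1 is a
unit. -/
theorem DNet.mem_of_elemGL_mem_normalizer (T : CentralUnits R) (τ : DNet n R) {i j : Fin n}
    (hij : i ≠ j) {x : R} (hx : elemGL hij x ∈ Subgroup.normalizer τ.netSubgroup) :
    x ∈ τ.ideal i j := by
  have h1 := (Subgroup.mem_normalizer_iff.1 hx (diagGL j (T.unit 1))).1
    (τ.diagonalSubgroup_le_netSubgroup (diagGL_mem_diagonalSubgroup _ _))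
  have h2 := h1.1 i j
  rw [elemGL_inv, elemGL_mul_diagGL_right, mul_assoc, elemGL_mul, Units.val_mul, coe_diagGL,
    coe_elemGL, add_mul, one_mul, Matrix.add_apply, Matrix.add_apply, one_apply_ne hij, zero_add,
    single_apply_same, single_mul_apply_of_ne _ _ _ _ _ hij, add_zero] at h2
  obtain ⟨s, hs⟩ := ((T.isUnit_sub_one (i := 1) (by decide)).map
    (Subring.center R).subtype).exists_right_inv
  have hs' : (T.unit 1 - 1 : R) * s = 1 := hs
  have h3 := TwoSidedIdeal.mul_mem_right _ _ s h2
  have h4 : (x * ↑(T.unit 1) + -x) * s = x := by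
    rw [← sub_eq_add_neg]
    calc _ = x * ((T.unit 1 - 1 : R) * s) := by noncomm_ring
      _ = x := by rw [hs', mul_one]
  rwa [h4] at h3

/-- If a, b ∈ F have entries generating the same two-sided ideals, then a⁻¹ b ∈ G(σ), so there are
at most as many cosets as matrices of ideals. -/
theorem finiteIndex_ofSubgroup (hF : HasFitting R) (T : CentralUnits R)
    (hD : diagonalSubgroup n R ≤ F) (hfin : Finite (TwoSidedIdeal R)) :
    ((DNet.ofSubgroup F hD (T.mem_closure_isUnit hF)).netSubgroup.subgroupOf F).FiniteIndex := by
  obtain ⟨σ, hσ⟩ : ∃ σ, σ = DNet.ofSubgroup F hD (T.mem_closure_isUnit hF) := ⟨_, rfl⟩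
  have hmem : ∀ a ∈ F, ∀ b : GeneralLinearGroup (Fin n) R,
      (∀ i j, TwoSidedIdeal.span {b i j} ≤ TwoSidedIdeal.span {a i j}) →
      (a⁻¹ * b).val ∈ σ.matrices := by
    intro a ha b hab k j
    by_cases hkj : k = j
    · subst hkj
      rw [DNet.diag]; trivial
    rw [Units.val_mul, Matrix.mul_apply]
    refine sum_mem fun i _ => ?_
    -- Allowing every w in the middle makes J a two-sided ideal; it contains a i j, hence b i j.
    let J : TwoSidedIdeal R := TwoSidedIdeal.mk' {x | ∀ w, (a⁻¹).val k i * w * x ∈ σ.ideal k j}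
      (fun w => by rw [mul_zero]; exact zero_mem _)
      (fun hx hy w => by rw [mul_add]; exact add_mem (hx w) (hy w))
      (fun hx w => by rw [mul_neg]; exact neg_mem (hx w))
      (fun {x y} hy w => by rw [← mul_assoc, mul_assoc _ w x]; exact hy (w * x))
      (fun hx w => by rw [← mul_assoc]; exact TwoSidedIdeal.mul_mem_right _ _ _ (hx w))
    have hJ : ∀ x, x ∈ J ↔ ∀ w, (a⁻¹).val k i * w * x ∈ σ.ideal k j := fun x =>
      TwoSidedIdeal.mem_mk' _ _ _ _ _ _ x
    have haJ : TwoSidedIdeal.span {a i j} ≤ J := by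
      rw [TwoSidedIdeal.span_le, Set.singleton_subset_iff, SetLike.mem_coe, hJ]
      intro w
      have := mul_mul_inv_mem_ofSubgroup hF T hD (inv_mem ha) i hkj w
      rwa [inv_inv, ← hσ] at this
    have hb : b i j ∈ J := haJ (hab i j (TwoSidedIdeal.subset_span rfl))
    simpa using (hJ _).1 hb 1
  let f : F → (Fin n → Fin n → TwoSidedIdeal R) := fun a i j => TwoSidedIdeal.span {a.1 i j}
  have hf : ∀ a b : F, f a = f b → a⁻¹ * b ∈ σ.netSubgroup.subgroupOf F := by
    intro a b hab
    have h := fun i j => congrFun (congrFun hab i) j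
    rw [Subgroup.mem_subgroupOf]
    refine ⟨hmem a a.2 b fun i j => (h i j).ge, ?_⟩
    have : (↑(a⁻¹ * b) : GeneralLinearGroup (Fin n) R)⁻¹ = (b.1)⁻¹ * a.1 := by simp
    rw [this]
    exact hmem b b.2 a fun i j => (h i j).le
  rw [← hσ]
  have : Finite (F ⧸ σ.netSubgroup.subgroupOf F) := by
    refine Finite.of_injective (fun q => f q.out) fun p q hpq => ?_
    rw [← QuotientGroup.out_eq' p, ← QuotientGroup.out_eq' q, QuotientGroup.eq]
    exact hf _ _ hpq
  exact Subgroup.finiteIndex_of_finite_quotient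

end main

theorem mainTheorem5 {R : Type*} [Ring R]
    (hArt : IsArtinian Rᵐᵒᵖ R ∨ IsArtinian R R)
    (hres : ∀ m : Ideal (Subring.center R), m.IsMaximal →
      7 ≤ ENat.card (Subring.center R ⧸ m))
    (n : ℕ) (F : Subgroup (Matrix.GeneralLinearGroup (Fin n) R)) (hF : diagonalSubgroup n R ≤ F) :
    ∃ σ : DNet n R,
      (σ.netSubgroup ≤ F ∧ F ≤ Subgroup.normalizer σ.netSubgroup) ∧
      (∀ τ : DNet n R,
        τ.netSubgroup ≤ F ∧ F ≤ Subgroup.normalizer τ.netSubgroup → τ = σ) ∧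
      (Finite (TwoSidedIdeal R) → (σ.netSubgroup.subgroupOf F).FiniteIndex) := by
  have hR := hasFitting_of_isArtinian hArt
  obtain ⟨T⟩ := exists_centralUnits hR hres
  refine ⟨DNet.ofSubgroup F hF (T.mem_closure_isUnit hR), ⟨?_, le_normalizer_ofSubgroup hR T hF⟩,
    fun τ hτ => ?_, finiteIndex_ofSubgroup hR T hF⟩
  · exact DNet.netSubgroup_le hR (wellFounded_idemLT hArt) _ hF fun i j h x hx =>
      DNet.mem_ofSubgroup.1 hx h
  · refine DNet.ext_of_ne fun i j hij => ?_
    ext x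
    rw [DNet.mem_ofSubgroup]
    exact ⟨fun hx h => hτ.1 (τ.elemGL_mem_netSubgroup h hx),
      fun hx => τ.mem_of_elemGL_mem_normalizer T hij (hτ.2 (hx hij))⟩
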